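/- Let $p$ be a prime, let $L/K$ be a finite Galois extension of fields of characteristic $p$ with Galois group $\Gamma$, and let $G$ be a finite group. For a field $k\in\{K,L\}$, a $kG$-Brauer pair is a pair $(P,e)$ consisting of a $p$-subgroup $P$ of $G$ and a block idempotent $e$ of $kC_G(P)$, i.e., a primitive idempotent $e$ of the center $Z(kC_G(P))$; the set of these pairs is denoted by $\mathcal{BP}(kG)$. Let $(kG)^P$ be the subalgebra of elements of $kG$ fixed under conjugation by $P$, and let $\mathrm{Br}_P\colon (kG)^P\to kC_G(P)$, $\sum_{g\in G}\alpha_g g\mapsto\sum_{g\in C_G(P)}\alpha_g g$, be the Brauer homomorphism. An idempotent $i$ of $(kG)^P$ is associated to $(P,e)$ if $e\,\mathrm{Br}_P(i)=\mathrm{Br}_P(i)\neq 0$. For $(Q,f),(P,e)\in\mathcal{BP}(kG)$ one writes $(Q,f)\le(P,e)$ if $Q\le P$ and every primitive idempotent $i$ of $(kG)^P$ which is associated to $(P,e)$ is also associated to $(Q,f)$. The group $\Gamma$ acts on $LC_G(P)$ through the coefficients, and on $\mathcal{BP}(LG)$ by ${}^\gamma(P,e)=(P,{}^\gamma e)$.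 For $(P,e)\in\mathcal{BP}(LG)$ let $\tilde e$ be the sum of the distinct $\Gamma$-conjugates of $e$; it is a block idempotent of $KC_G(P)$, so that $(P,\tilde e)\in\mathcal{BP}(KG)$. **Proposition.** For $(Q,f),(P,e)\in\mathcal{BP}(LG)$ with $Q\le P$, the following are equivalent: (i) $(Q,\tilde f)\le(P,\tilde e)$ in $\mathcal{BP}(KG)$. (ii) There exists $\gamma\in\Gamma$ such that $(Q,f)\le{}^\gamma(P,e)$ in $\mathcal{BP}(LG)$. -/

import Mathlib

/-- A primitive idempotent of a ring: a nonzero idempotent that is not the sum of two nonzero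
orthogonal idempotents. -/
def IsPrimitiveIdempotent {A : Type*} [Ring A] (i : A) : Prop :=
  IsIdempotentElem i ∧ i ≠ 0 ∧
    ∀ a b : A, IsIdempotentElem a → IsIdempotentElem b → a * b = 0 → b * a = 0 → i = a + b →
      a = 0 ∨ b = 0

/-- A block idempotent of a ring `A`: a primitive idempotent of the center `Z(A)`. -/
def IsBlockIdempotent {A : Type*} [Ring A] (e : A) : Prop :=
  ∃ z : Subring.center A, (z : A) = e ∧ IsPrimitiveIdempotent z

theorem isBlockIdempotent_iff {A : Type*} [Ring A] (e : A) :
    IsBlockIdempotent e ↔ e ∈ Subring.center A ∧ IsIdempotentElem e ∧ e ≠ 0 ∧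
      ∀ a ∈ Subring.center A, ∀ b ∈ Subring.center A, IsIdempotentElem a → IsIdempotentElem b →
        a * b = 0 → e = a + b → a = 0 ∨ b = 0 := by
  constructor
  · rintro ⟨z, rfl, hz, hz0, hp⟩
    refine ⟨z.2, congrArg Subtype.val hz, fun h => hz0 (Subtype.ext h), ?_⟩
    intro a ha b hb hai hbi hab hs
    have := hp ⟨a, ha⟩ ⟨b, hb⟩ (Subtype.ext hai) (Subtype.ext hbi) (Subtype.ext hab)
      (Subtype.ext (((Subring.mem_center_iff.1 ha) b).trans hab)) (Subtype.ext hs)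
    exact this.imp (congrArg Subtype.val) (congrArg Subtype.val)
  · rintro ⟨hc, hi, h0, hp⟩
    refine ⟨⟨e, hc⟩, rfl, Subtype.ext hi, fun h => h0 (congrArg Subtype.val h), ?_⟩
    intro a b hai hbi hab _ hs
    have := hp a a.2 b b.2 (congrArg Subtype.val hai) (congrArg Subtype.val hbi)
      (congrArg Subtype.val hab) (congrArg Subtype.val hs)
    exact this.imp (fun h => Subtype.ext h) (fun h => Subtype.ext h)

/-- Distinct block idempotents are orthogonal. -/
theorem IsBlockIdempotent.mul_eq_zero_of_ne {A : Type*} [Ring A] {e f : A}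
    (he : IsBlockIdempotent e) (hf : IsBlockIdempotent f) (hne : e ≠ f) : e * f = 0 := by
  rw [isBlockIdempotent_iff] at he hf
  obtain ⟨hec, hei, -, hep⟩ := he
  obtain ⟨hfc, hfi, -, hfp⟩ := hf
  have hcomm : f * e = e * f := Subring.mem_center_iff.1 hec f
  have hef : IsIdempotentElem (e * f) := IsIdempotentElem.mul_of_commute hcomm.symm hei hfi
  have hei' : e * e = e := hei
  have hfi' : f * f = f := hfi
  have hefc : e * f ∈ Subring.center A := mul_mem hec hfc
  have h1 : e * (e * f) = e * f := by rw [← mul_assoc, hei']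
  have h2 : (e * f) * e = e * f := by rw [mul_assoc, hcomm, h1]
  have h3 : (e * f) * f = e * f := by rw [mul_assoc, hfi']
  have h4 : f * (e * f) = e * f := by rw [← mul_assoc, hcomm, h3]
  have hef' : e * f * (e * f) = e * f := hef
  have A1 := hep (e * f) hefc (e - e * f) (sub_mem hec hefc) hef
    (by unfold IsIdempotentElem; rw [mul_sub, sub_mul, sub_mul, hei', h1, h2, hef']; abel)
    (by rw [mul_sub, h2, hef', sub_self]) (by abel)
  have A2 := hfp (e * f) hefc (f - e * f) (sub_mem hfc hefc) hef
    (by unfold IsIdempotentElem; rw [mul_sub, sub_mul, sub_mul, hfi', h3, h4, hef']; abel)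
    (by rw [mul_sub, h3, hef', sub_self]) (by abel)
  rcases A1 with h | h
  · exact h
  · rcases A2 with h' | h'
    · exact h'
    · exact absurd ((sub_eq_zero.1 h).trans (sub_eq_zero.1 h').symm) hne

/-- Block idempotents are preserved by ring automorphisms. -/
theorem IsBlockIdempotent.map_equiv {A : Type*} [Ring A] {e : A} (he : IsBlockIdempotent e)
    (φ : A ≃+* A) : IsBlockIdempotent (φ e) := by
  have hcen : ∀ (ψ : A ≃+* A) (a : A), a ∈ Subring.center A → ψ a ∈ Subring.center A := by
    intro ψ a ha
    rw [Subring.mem_center_iff] at ha ⊢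
    intro g
    have := congrArg ψ (ha (ψ.symm g))
    simpa using this
  rw [isBlockIdempotent_iff] at he ⊢
  obtain ⟨hc, hi, h0, hp⟩ := he
  refine ⟨hcen φ e hc, hi.map φ, by simpa using h0, ?_⟩
  intro a ha b hb hai hbi hab hs
  have := hp (φ.symm a) (hcen _ a ha) (φ.symm b) (hcen _ b hb) (hai.map φ.symm) (hbi.map φ.symm)
    (by rw [← map_mul, hab, map_zero]) (by rw [← map_add, ← hs, RingEquiv.symm_apply_apply])
  simpa using this

section GroupAlgebra

variable {k G : Type*} [Field k] [Group G]

/-- The conjugation automorphism `a ↦ x a x⁻¹` of the group algebra `kG`. -/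
noncomputable def groupAlgebraConj (k : Type*) {G : Type*} [Field k] [Group G] (x : G) :
    MonoidAlgebra k G ≃ₐ[k] MonoidAlgebra k G :=
  MonoidAlgebra.domCongr k k (MulAut.conj x)

/-- The fixed point subalgebra `(kG)^P` under the conjugation action of a subgroup `P`. -/
noncomputable def fixedSubalgebra (k : Type*) {G : Type*} [Field k] [Group G] (P : Subgroup G) :
    Subalgebra k (MonoidAlgebra k G) where
  carrier := {a | ∀ x ∈ P, groupAlgebraConj k x a = a}
  mul_mem' ha hb x hx := by rw [map_mul, ha x hx, hb x hx]
  add_mem' ha hb x hx := by rw [map_add, ha x hx, hb x hx]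
  algebraMap_mem' r x _ := AlgEquiv.commutes _ r

theorem fixedSubalgebra_anti {Q P : Subgroup G} (h : Q ≤ P) :
    fixedSubalgebra k P ≤ fixedSubalgebra k Q :=
  fun _ ha x hx => ha x (h hx)

/-- The Brauer homomorphism `Br_P : (kG)^P → kC_G(P)`, which forgets the coefficients at the group
elements outside `C_G(P)`. -/
noncomputable def brauerMap (k : Type*) {G : Type*} [Field k] [Group G] (P : Subgroup G) :
    fixedSubalgebra k P →ₗ[k] MonoidAlgebra k (Subgroup.centralizer (P : Set G)) where
  toFun a := MonoidAlgebra.comapDomain (Subgroup.centralizer (P : Set G)).subtype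
    Subtype.val_injective (a : MonoidAlgebra k G)
  map_add' _ _ := MonoidAlgebra.comapDomain_add _ _ _ _
  map_smul' _ _ := by ext; simp

/-- A `kG`-Brauer pair `(P, e)`: a `p`-subgroup `P` of `G` and a block idempotent `e` of
`kC_G(P)`. -/
structure BrauerPair (p : ℕ) (k G : Type*) [Field k] [Group G] where
  /-- the `p`-subgroup `P` -/
  subgroup : Subgroup G
  isPGroup : IsPGroup p subgroup
  /-- the block idempotent `e` of `kC_G(P)` -/
  idem : MonoidAlgebra k (Subgroup.centralizer (subgroup : Set G))
  isBlockIdempotent : IsBlockIdempotent idem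

namespace BrauerPair

variable {p : ℕ}

/-- An element `i` of `(kG)^P` (in practice an idempotent) is associated to `(P, e)` if
`e Br_P(i) = Br_P(i) ≠ 0`. -/
def IsAssociated (X : BrauerPair p k G) (i : fixedSubalgebra k X.subgroup) : Prop :=
  X.idem * brauerMap k X.subgroup i = brauerMap k X.subgroup i ∧ brauerMap k X.subgroup i ≠ 0

/-- `(Q, f) ≤ (P, e)` if `Q ≤ P` and every primitive idempotent `i` of `(kG)^P` associated to
`(P, e)` is, as an element of `(kG)^Q`, also associated to `(Q, f)`. -/
instance : LE (BrauerPair p k G) where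
  le X Y := ∃ h : X.subgroup ≤ Y.subgroup, ∀ i : fixedSubalgebra k Y.subgroup,
    IsPrimitiveIdempotent i → Y.IsAssociated i →
      X.IsAssociated (Subalgebra.inclusion (fixedSubalgebra_anti h) i)

end BrauerPair

end GroupAlgebra

section Galois

/- The Galois group `Γ = L ≃ₐ[K] L` acts on a group algebra `LH` through the coefficients; this is
Mathlib's action `γ • a`. -/

variable {K L H : Type*} [Field K] [Field L] [Algebra K L] [Group H]

theorem galois_smul_eq (γ : L ≃ₐ[K] L) (a : MonoidAlgebra L H) :
    γ • a = MonoidAlgebra.mapRingEquiv H γ.toRingEquiv a := by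
  ext h
  simp

theorem galois_smul_mul (γ : L ≃ₐ[K] L) (a b : MonoidAlgebra L H) :
    γ • (a * b) = (γ • a) * (γ • b) := by
  simp only [galois_smul_eq, map_mul]

theorem IsBlockIdempotent.galois_smul {b : MonoidAlgebra L H} (hb : IsBlockIdempotent b)
    (γ : L ≃ₐ[K] L) : IsBlockIdempotent (γ • b) := by
  rw [galois_smul_eq]
  exact hb.map_equiv _

/-- The sum of the distinct `Γ`-conjugates of `b`, that is `∑ γ b` over `γ ∈ [Γ/Γ_b]`. -/
noncomputable def galoisOrbitSum (K : Type*) {L H : Type*} [Field K] [Field L] [Algebra K L]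
    [Group H] (b : MonoidAlgebra L H) : MonoidAlgebra L H :=
  ∑ᶠ c ∈ MulAction.orbit (L ≃ₐ[K] L) b, c

/-- The embedding `KH ⊆ LH`. -/
noncomputable def groupAlgebraEmbedding (K L H : Type*) [Field K] [Field L] [Algebra K L]
    [Group H] : MonoidAlgebra K H →+* MonoidAlgebra L H :=
  MonoidAlgebra.mapRingHom H (algebraMap K L)

theorem groupAlgebraEmbedding_injective :
    Function.Injective (groupAlgebraEmbedding K L H) :=
  MonoidAlgebra.map_injective (algebraMap K L).toAddMonoidHom (algebraMap K L).injective

theorem galois_smul_embedding (γ : L ≃ₐ[K] L) (a : MonoidAlgebra K H) :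
    γ • groupAlgebraEmbedding K L H a = groupAlgebraEmbedding K L H a := by
  ext h
  simp [groupAlgebraEmbedding]

theorem groupAlgebraEmbedding_mem_center {a : MonoidAlgebra K H} :
    groupAlgebraEmbedding K L H a ∈ Subring.center (MonoidAlgebra L H) ↔
      a ∈ Subring.center (MonoidAlgebra K H) := by
  constructor
  · intro h
    rw [Subring.mem_center_iff] at h ⊢
    intro g
    apply groupAlgebraEmbedding_injective (L := L)
    rw [map_mul, map_mul, h]
  · intro h
    rw [Subring.mem_center_iff] at h ⊢
    intro g
    induction g using MonoidAlgebra.induction_linear with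
    | zero => simp
    | add f g hf hg => rw [add_mul, mul_add, hf, hg]
    | single x r =>
      have h1 := congrArg (groupAlgebraEmbedding K L H) (h (MonoidAlgebra.single x 1))
      rw [map_mul, map_mul] at h1
      have h2 : groupAlgebraEmbedding K L H (MonoidAlgebra.single x 1) =
          MonoidAlgebra.single x 1 := by simp [groupAlgebraEmbedding]
      rw [h2] at h1
      have h3 : (MonoidAlgebra.single x r : MonoidAlgebra L H) =
          r • MonoidAlgebra.single x 1 := by simp
      rw [h3, smul_mul_assoc, mul_smul_comm, h1]

variable [FiniteDimensional K L]

theorem galois_smul_orbitSum (γ : L ≃ₐ[K] L) (b : MonoidAlgebra L H) :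
    γ • galoisOrbitSum K b = galoisOrbitSum K b := by
  have hfin : (MulAction.orbit (L ≃ₐ[K] L) b).Finite := Set.finite_range _
  have hmem : ∀ (δ : L ≃ₐ[K] L), ∀ c ∈ MulAction.orbit (L ≃ₐ[K] L) b,
      δ • c ∈ MulAction.orbit (L ≃ₐ[K] L) b := by
    rintro δ _ ⟨ε, rfl⟩
    exact ⟨δ * ε, mul_smul δ ε b⟩
  unfold galoisOrbitSum
  rw [finsum_mem_eq_finite_toFinset_sum _ hfin, Finset.smul_sum]
  refine Finset.sum_bij (fun c _ => γ • c) ?_ ?_ ?_ ?_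
  · intro c hc
    rw [Set.Finite.mem_toFinset] at hc ⊢
    exact hmem _ c hc
  · intro c _ d _ h
    exact smul_left_cancel γ h
  · intro c hc
    rw [Set.Finite.mem_toFinset] at hc
    exact ⟨γ⁻¹ • c, by rw [Set.Finite.mem_toFinset]; exact hmem _ c hc,
      smul_inv_smul γ c⟩
  · intro c _
    rfl

/-- The sum of the distinct `Γ`-conjugates of a block idempotent of `LH` is a block idempotent
of `KH`. -/
theorem exists_galoisDescent [IsGalois K L] {b : MonoidAlgebra L H} (hb : IsBlockIdempotent b) :
    ∃ c : MonoidAlgebra K H,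
      groupAlgebraEmbedding K L H c = galoisOrbitSum K b ∧ IsBlockIdempotent c := by
  have hfin : (MulAction.orbit (L ≃ₐ[K] L) b).Finite := Set.finite_range _
  have hblock : ∀ c ∈ hfin.toFinset, IsBlockIdempotent c := by
    intro c hc
    rw [Set.Finite.mem_toFinset] at hc
    obtain ⟨γ, rfl⟩ := hc
    exact hb.galois_smul γ
  have hsum : galoisOrbitSum K b = ∑ c ∈ hfin.toFinset, c :=
    finsum_mem_eq_finite_toFinset_sum _ hfin
  have hmul : ∀ c ∈ hfin.toFinset, c * galoisOrbitSum K b = c := by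
    intro c hc
    rw [hsum, Finset.mul_sum, Finset.sum_eq_single c]
    · exact ((isBlockIdempotent_iff c).1 (hblock c hc)).2.1
    · intro d hd hne
      exact (hblock c hc).mul_eq_zero_of_ne (hblock d hd) hne.symm
    · intro h
      exact absurd hc h
  have hbmem : b ∈ hfin.toFinset := by
    rw [Set.Finite.mem_toFinset]
    exact MulAction.mem_orbit_self b
  have hidem : IsIdempotentElem (galoisOrbitSum K b) := by
    unfold IsIdempotentElem
    conv_lhs => enter [1]; rw [hsum]
    rw [Finset.sum_mul, Finset.sum_congr rfl hmul, ← hsum]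
  have hrange : galoisOrbitSum K b ∈ Set.range (groupAlgebraEmbedding K L H) := by
    have := MonoidAlgebra.range_map (M := H) (algebraMap K L).toAddMonoidHom
    change galoisOrbitSum K b ∈ Set.range (MonoidAlgebra.map (algebraMap K L).toAddMonoidHom)
    rw [this]
    intro h
    have hx := (IsGalois.mem_range_algebraMap_iff_fixed (F := K)
      ((galoisOrbitSum K b).coeff h)).2 (fun γ => by
        conv_rhs => rw [← galois_smul_orbitSum γ b]
        rfl)
    exact hx
  obtain ⟨c, hc⟩ := hrange
  obtain ⟨hbc, hbi, hb0, hbp⟩ := (isBlockIdempotent_iff b).1 hb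
  refine ⟨c, hc, (isBlockIdempotent_iff c).2 ⟨?_, ?_, ?_, ?_⟩⟩
  · rw [← groupAlgebraEmbedding_mem_center (L := L), hc, hsum]
    exact sum_mem fun d hd => ((isBlockIdempotent_iff d).1 (hblock d hd)).1
  · apply groupAlgebraEmbedding_injective (L := L)
    rw [map_mul, hc]
    exact hidem
  · rintro rfl
    have := hmul b hbmem
    rw [← hc, map_zero, mul_zero] at this
    exact hb0 this.symm
  · have key : ∀ a : MonoidAlgebra K H, c * a = a →
        b * groupAlgebraEmbedding K L H a = 0 → a = 0 := by
      intro a hca ha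
      apply groupAlgebraEmbedding_injective (L := L)
      rw [map_zero, ← hca, map_mul, hc, hsum, Finset.sum_mul]
      refine Finset.sum_eq_zero fun d hd => ?_
      rw [Set.Finite.mem_toFinset] at hd
      obtain ⟨γ, rfl⟩ := hd
      change (γ • b) * _ = 0
      rw [← galois_smul_embedding γ a, ← galois_smul_mul, ha, smul_zero]
    intro x hx y hy hxi hyi hxy hs
    have hxi' : x * x = x := hxi
    have hyi' : y * y = y := hyi
    have hyx : y * x = 0 := (Subring.mem_center_iff.1 hx y).trans hxy
    have hx' := groupAlgebraEmbedding_mem_center (L := L).2 hx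
    have hy' := groupAlgebraEmbedding_mem_center (L := L).2 hy
    have hcomm : ∀ z ∈ Subring.center (MonoidAlgebra L H), Commute b z := fun z hz =>
      Subring.mem_center_iff.1 hz b
    have := hbp _ (mul_mem hbc hx') _ (mul_mem hbc hy')
      (IsIdempotentElem.mul_of_commute (hcomm _ hx') hbi (hxi.map (groupAlgebraEmbedding K L H)))
      (IsIdempotentElem.mul_of_commute (hcomm _ hy') hbi (hyi.map (groupAlgebraEmbedding K L H)))
      (by
        rw [mul_assoc, ← mul_assoc _ b, ← (hcomm _ hx').eq, mul_assoc, ← map_mul, hxy]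
        simp)
      (by rw [← mul_add, ← map_add, ← hs, hc, hmul b hbmem])
    refine this.imp (key x ?_) (key y ?_)
    · rw [hs, add_mul, hxi', hyx, add_zero]
    · rw [hs, add_mul, hyi', hxy, zero_add]

end Galois

namespace BrauerPair

variable {p : ℕ} {K L G : Type*} [Field K] [Field L] [Algebra K L] [Group G]

/-- The action `γ(P, e) = (P, γ e)` of the Galois group on the `LG`-Brauer pairs. -/
noncomputable instance : MulAction (L ≃ₐ[K] L) (BrauerPair p L G) where
  smul γ X := ⟨X.subgroup, X.isPGroup, γ • X.idem, X.isBlockIdempotent.galois_smul γ⟩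
  one_smul X := by
    cases X
    change BrauerPair.mk _ _ _ _ = _
    congr
    exact one_smul _ _
  mul_smul γ δ X := by
    cases X
    change BrauerPair.mk _ _ _ _ = BrauerPair.mk _ _ _ _
    congr 1
    exact mul_smul _ _ _

variable [FiniteDimensional K L] [IsGalois K L]

/-- The `KG`-Brauer pair `(P, ẽ)` of an `LG`-Brauer pair `(P, e)`, where `ẽ` is the element of
`KC_G(P)` whose image in `LC_G(P)` is the sum of the distinct Galois conjugates of `e`. -/
noncomputable def tilde (K : Type*) [Field K] [Algebra K L] [FiniteDimensional K L] [IsGalois K L]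
    (X : BrauerPair p L G) : BrauerPair p K G where
  subgroup := X.subgroup
  isPGroup := X.isPGroup
  idem := (exists_galoisDescent (K := K) X.isBlockIdempotent).choose
  isBlockIdempotent := (exists_galoisDescent (K := K) X.isBlockIdempotent).choose_spec.2

theorem embedding_tilde_idem (X : BrauerPair p L G) :
    groupAlgebraEmbedding K L (Subgroup.centralizer (X.subgroup : Set G)) (X.tilde K).idem =
      galoisOrbitSum K X.idem :=
  (exists_galoisDescent (K := K) X.isBlockIdempotent).choose_spec.1

end BrauerPair

/-! Two facts over a field `k` of characteristic `p` carry the argument. Below a given pair `(P, e)`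
there is, for each `Q ≤ P`, a pair `(Q, f)` (`exists_block_le`). It is unique: `(P, e)` has an
associated primitive idempotent `i`, and orthogonal blocks cannot both act as the identity on
`Br_Q(i) ≠ 0` (`eq_of_mul_eq`).

These facts show that `(Q, f) ≤ (P, e)` over `L` implies `(Q, f̃) ≤ (P, ẽ)` over `K`
(`tilde_le_tilde`). Existence over `K` gives some `(Q, c) ≤ (P, ẽ)`. A primitive idempotent of
`(KG)^P` associated to `ẽ` has a primitive constituent over `L` associated to `e`. On its nonzero
image under `Br_Q`, both `c` and `f` act as the identity, so `c f̃ ≠ 0` and `c = f̃`. Since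
conjugate pairs have the same `tilde`, (ii) implies (i).

Conversely, choose `(Q, f') ≤ (P, e)` over `L`. Then `f̃'` and `f̃` both lie below `ẽ`, so they
agree by uniqueness. Hence `f = γ f'` for some `γ`, and applying `γ` to the chosen inclusion gives
(ii).

Existence is proved by descending induction on `Q`. For `Q < P` and `N = N_P(Q)`, take an `N`-stable
block `f` of `kC_G(Q)` covering the block already found at `N`. That `1 - f` kills `Br_Q(i)` can be
tested at the subgroups strictly between `Q` and `N` and at `N` itself
(`centralizerTrunc_mul_eq_zero`). -/

/-- `i` is a primitive idempotent of the subalgebra `Z`, expressed in the ambient algebra. -/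
def Subalgebra.IsPrimitiveIn {k A : Type*} [Field k] [Ring A] [Algebra k A] (Z : Subalgebra k A)
    (i : A) : Prop :=
  i ∈ Z ∧ i * i = i ∧ i ≠ 0 ∧ ∀ c ∈ Z, c * c = c → i * c = c → c * i = c → c = 0 ∨ c = i

/-! ### Primitive idempotents in finite-dimensional algebras. -/

section Idempotents

variable {k A : Type*} [Field k] [Ring A] [Algebra k A] {Z : Subalgebra k A} {i : A}

theorem isPrimitiveIdempotent_iff_isPrimitiveIn {i : Z} :
    IsPrimitiveIdempotent i ↔ Z.IsPrimitiveIn (i : A) := by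
  constructor
  · rintro ⟨hi, h0, hp⟩
    have hii : i * i = i := hi
    refine ⟨i.2, congrArg Subtype.val hi, fun h => h0 (Subtype.ext h), fun c hc hcc h1 h2 => ?_⟩
    lift c to Z using hc
    have hcc : c * c = c := Subtype.ext hcc
    have h1 : i * c = c := Subtype.ext h1
    have h2 : c * i = c := Subtype.ext h2
    rcases hp c (i - c) hcc
      (by unfold IsIdempotentElem; rw [mul_sub, sub_mul, sub_mul, hii, hcc, h1, h2]; abel)
      (by rw [mul_sub, h2, hcc, sub_self]) (by rw [sub_mul, h1, hcc, sub_self]) (by abel) with h | h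
    · exact Or.inl (congrArg Subtype.val h)
    · exact Or.inr (congrArg Subtype.val (sub_eq_zero.1 h).symm)
  · rintro ⟨-, hi, h0, hp⟩
    refine ⟨Subtype.ext hi, fun h => h0 (congrArg Subtype.val h), ?_⟩
    rintro a b ha hb hab hba rfl
    have ha' : a * a = a := ha
    rcases hp a a.2 (congrArg Subtype.val ha)
      (congrArg Subtype.val (show (a + b) * a = a by rw [add_mul, ha', hba, add_zero]))
      (congrArg Subtype.val (show a * (a + b) = a by rw [mul_add, ha', hab, add_zero])) with h | h
    · exact Or.inl (Subtype.ext h)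
    · exact Or.inr (by simpa using (Subtype.ext h : a = a + b))

/-- Since `c` commutes with `i`, the product `c * i` is an idempotent of the corner of `i`, so
primitivity leaves only `0` and `i`. -/
theorem Subalgebra.IsPrimitiveIn.mul_eq_or {c : A} (hi : Z.IsPrimitiveIn i) (hc : c ∈ Z)
    (hcc : c * c = c) (hcomm : c * i = i * c) : c * i = 0 ∨ c * i = i := by
  obtain ⟨hiZ, hii, -, hp⟩ := hi
  refine hp _ (mul_mem hc hiZ) ?_ ?_ ?_
  · rw [mul_assoc, ← mul_assoc i, ← hcomm, mul_assoc, hii, ← mul_assoc, hcc]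
  · rw [hcomm, ← mul_assoc, hii]
  · rw [mul_assoc, hii]

theorem Subalgebra.IsPrimitiveIn.mul_eq_zero (hZ : ∀ a ∈ Z, ∀ b ∈ Z, a * b = b * a) {e f : A}
    (he : Z.IsPrimitiveIn e) (hf : Z.IsPrimitiveIn f) (hne : e ≠ f) : e * f = 0 := by
  have hc := hZ e he.1 f hf.1
  rcases hf.mul_eq_or he.1 he.2.1 hc with h | h
  · exact h
  · rcases he.mul_eq_or hf.1 hf.2.1 hc.symm with h' | h'
    · rw [hc, h']
    · exact absurd (by rw [← h', ← hc, h]) hne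

variable [FiniteDimensional k A]

/-- In a corner of a primitive idempotent every element is nilpotent or invertible. -/
theorem Subalgebra.IsPrimitiveIn.isNilpotent_or (hi : Z.IsPrimitiveIn i) {a : A} (ha : a ∈ Z)
    (h1 : i * a = a) (h2 : a * i = a) : IsNilpotent a ∨ ∃ b ∈ Z, a * b = i := by
  obtain ⟨hiZ, hii, -, hp⟩ := hi
  let R := Algebra.adjoin k {a}
  have : IsMulCommutative R := Algebra.isMulCommutative_adjoin k (by simp)
  have : IsArtinianRing R := IsArtinianRing.of_finite k R
  let r : R := ⟨a, Algebra.self_mem_adjoin_singleton k a⟩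
  -- Fitting's argument in the commutative Artinian ring `k[a]`: the powers of `a` stabilise, `r ^
  -- (n + 1) * y = r ^ n`, which makes `r ^ (n + 1) * y ^ (n + 1)` an idempotent of the corner. If
  -- it is `0` then `a` is nilpotent; if it is `i` then `a` divides `i`.
  obtain ⟨n, y, hy⟩ := IsArtinian.exists_pow_succ_smul_dvd r (1 : R)
  simp only [smul_eq_mul, mul_one] at hy
  have hpow : ∀ m : ℕ, r ^ (n + 1) * (r ^ m * y ^ m) = r ^ (n + 1) := by
    intro m
    induction m with
    | zero => simp
    | succ m ih =>
      calc r ^ (n + 1) * (r ^ (m + 1) * y ^ (m + 1))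
          = (r ^ n.succ * y) * r * (r ^ m * y ^ m) := by rw [Nat.succ_eq_add_one]; ring
        _ = r ^ (n + 1) * (r ^ m * y ^ m) := by rw [hy]; ring
        _ = _ := ih
  have hpow' := hpow (n + 1)
  have hid : (r ^ (n + 1) * y ^ (n + 1)) * (r ^ (n + 1) * y ^ (n + 1))
      = r ^ (n + 1) * y ^ (n + 1) := by
    calc _ = (r ^ (n + 1) * (r ^ (n + 1) * y ^ (n + 1))) * y ^ (n + 1) := by ring
      _ = _ := by rw [hpow']
  have hyZ : (y : A) ∈ Z := (Algebra.adjoin_le (by simpa using ha) : R ≤ Z) y.2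
  have e1 : ((r ^ (n + 1) * y ^ (n + 1) : R) : A) = a * (a ^ n * (y : A) ^ (n + 1)) := by
    change a ^ (n + 1) * (y : A) ^ (n + 1) = _
    rw [pow_succ', mul_assoc]
  have e2 : ((r ^ (n + 1) * y ^ (n + 1) : R) : A) = (y : A) ^ (n + 1) * a ^ n * a := by
    rw [mul_comm]
    change (y : A) ^ (n + 1) * a ^ (n + 1) = _
    rw [pow_succ, pow_succ a, mul_assoc, mul_assoc, mul_assoc]
  have hmem : a ^ n * (y : A) ^ (n + 1) ∈ Z := mul_mem (pow_mem ha _) (pow_mem hyZ _)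
  rcases hp ((r ^ (n + 1) * y ^ (n + 1) : R) : A) (e1 ▸ mul_mem ha hmem)
    (congrArg Subtype.val hid) (by rw [e1, ← mul_assoc, h1]) (by rw [e2, mul_assoc, h2]) with h | h
  · left
    have hz : r ^ (n + 1) * y ^ (n + 1) = 0 := Subtype.ext h
    refine ⟨n + 1, ?_⟩
    rw [hz, mul_zero] at hpow'
    exact congrArg Subtype.val hpow'.symm
  · exact Or.inr ⟨_, hmem, by rw [← e1, h]⟩

/-- An idempotent on which an additive map does not vanish has a primitive constituent on which the
map does not vanish. -/
theorem exists_isPrimitiveIn_map_ne_zero {M : Type*} [AddCommGroup M] (φ : A →+ M)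
    (hiZ : i ∈ Z) (hii : i * i = i) (h : φ i ≠ 0) :
    ∃ j, Z.IsPrimitiveIn j ∧ i * j = j ∧ j * i = j ∧ φ j ≠ 0 := by
  -- Induction on the dimension of the right ideal `iA`, which drops strictly on passing to a proper
  -- subidempotent. When `i = c + (i - c)`, additivity keeps `φ` nonzero on one of the two summands.
  induction hn : Module.finrank k (LinearMap.range (LinearMap.mulLeft k i)) using
    Nat.strong_induction_on generalizing i with
  | _ n ih =>
  have step : ∀ c ∈ Z, c * c = c → i * c = c → c * i = c → c ≠ i → φ c ≠ 0 →
      ∃ j, Z.IsPrimitiveIn j ∧ i * j = j ∧ j * i = j ∧ φ j ≠ 0 := by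
    intro c hc hcc h1 h2 hci hφ
    have hlt : LinearMap.range (LinearMap.mulLeft k c) < LinearMap.range (LinearMap.mulLeft k i) := by
      refine lt_of_le_of_ne ?_ fun heq => hci ?_
      · rintro _ ⟨x, rfl⟩
        exact ⟨c * x, by simp [← mul_assoc, h1]⟩
      · have : i ∈ LinearMap.range (LinearMap.mulLeft k c) := heq ▸ ⟨i, by simp [hii]⟩
        obtain ⟨x, hx⟩ := this
        rw [LinearMap.mulLeft_apply] at hx
        rw [← h2, ← hx, ← mul_assoc, hcc]
    obtain ⟨j, hj, hj1, hj2, hj3⟩ :=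
      ih _ (hn ▸ Submodule.finrank_lt_finrank_of_lt hlt) hc hcc hφ rfl
    exact ⟨j, hj, by rw [← hj1, ← mul_assoc, h1], by rw [← hj2, mul_assoc, h2], hj3⟩
  by_cases hprim : Z.IsPrimitiveIn i
  · exact ⟨i, hprim, hii, hii, h⟩
  · have h0 : i ≠ 0 := by rintro rfl; simp at h
    simp only [Subalgebra.IsPrimitiveIn, not_and, not_forall, not_or] at hprim
    obtain ⟨c, hc, hcc, h1, h2, hc0, hci⟩ := hprim hiZ hii h0
    by_cases hφ : φ c = 0
    · refine step (i - c) (sub_mem hiZ hc) ?_ ?_ ?_ (by simpa using hc0) (by simpa [hφ] using h)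
      · rw [mul_sub, sub_mul, sub_mul, hii, hcc, h1, h2]; abel
      · rw [mul_sub, hii, h1]
      · rw [sub_mul, hii, h2]
    · exact step c hc hcc h1 h2 hci hφ

/-- Distinct primitive idempotents of a commutative subalgebra are orthogonal and nonzero, hence
linearly independent. -/
theorem finite_setOf_isPrimitiveIn (hZ : ∀ a ∈ Z, ∀ b ∈ Z, a * b = b * a) :
    {f | Z.IsPrimitiveIn f}.Finite := by
  have : LinearIndependent k (fun f : {f | Z.IsPrimitiveIn f} => (f : A)) := by
    rw [linearIndependent_iff']
    intro s g hs e he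
    have h := congrArg ((e : A) * ·) hs
    simp only [Finset.mul_sum, mul_zero, mul_smul_comm] at h
    rw [Finset.sum_eq_single e, e.2.2.1] at h
    · exact (smul_eq_zero.1 h).resolve_right e.2.2.2.1
    · intro f _ hfe
      rw [e.2.mul_eq_zero hZ f.2 fun h => hfe (Subtype.ext h.symm), smul_zero]
    · exact fun h => absurd he h
  exact this.setFinite

/-- The primitive idempotents of a commutative finite-dimensional algebra sum to one. -/
theorem sum_isPrimitiveIn_eq_one (hZ : ∀ a ∈ Z, ∀ b ∈ Z, a * b = b * a) :
    ∑ f ∈ (finite_setOf_isPrimitiveIn hZ).toFinset, f = 1 := by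
  set s := (finite_setOf_isPrimitiveIn hZ).toFinset with hs
  have hmem : ∀ f, f ∈ s ↔ Z.IsPrimitiveIn f := fun f => by simp [hs]
  have hmul : ∀ f ∈ s, f * ∑ e ∈ s, e = f := by
    intro f hf
    rw [Finset.mul_sum, Finset.sum_eq_single f, ((hmem f).1 hf).2.1]
    · intro e he hne
      exact ((hmem f).1 hf).mul_eq_zero hZ ((hmem e).1 he) hne.symm
    · exact fun h => absurd hf h
  have hsum : (∑ e ∈ s, e) * ∑ e ∈ s, e = ∑ e ∈ s, e := by
    rw [Finset.sum_mul, Finset.sum_congr rfl hmul]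
  by_contra hne
  -- A nonzero complement `1 - ∑ e` would contain a primitive `j`, but `j` is itself a term of the
  -- sum and is therefore killed by the complement.
  obtain ⟨j, hj, hj1, hj2, -⟩ := exists_isPrimitiveIn_map_ne_zero (Z := Z) (AddMonoidHom.id A)
    (i := 1 - ∑ e ∈ s, e) (sub_mem (one_mem _) (sum_mem fun f hf => ((hmem f).1 hf).1))
    (by rw [mul_sub, sub_mul, sub_mul, hsum]; simp) (by simpa [sub_eq_zero] using Ne.symm hne)
  rw [mul_sub, hmul j ((hmem j).2 hj), mul_one, sub_self] at hj2
  exact hj.2.2.1 hj2.symm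

end Idempotents

/-- Nontrivial orbits of a `p`-group contribute multiples of `p`. The fibres of `f` are stable, so
each value is counted, modulo `p`, by the fixed points in its fibre. -/
theorem IsPGroup.sum_eq_sum_fixed {p : ℕ} [Fact p.Prime] {H : Type*} [Group H] (hH : IsPGroup p H)
    {α M : Type*} [AddCommGroup M] (hM : ∀ m : M, p • m = 0) (φ : H →* Equiv.Perm α)
    (s : Finset α) (hs : ∀ x, ∀ a ∈ s, φ x a ∈ s) (f : α → M) (hf : ∀ x, ∀ a ∈ s, f (φ x a) = f a)
    [DecidablePred fun a => ∀ x, φ x a = a] :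
    ∑ a ∈ s, f a = ∑ a ∈ s with ∀ x, φ x a = a, f a := by
  classical
  have h1 : ∀ t : Finset α, ∑ a ∈ t, f a = ∑ b ∈ t.image f, (t.filter (f · = b)).card • b :=
    fun t => Finset.sum_comp (fun b => b) f
  rw [h1, h1, Finset.sum_subset (Finset.image_subset_image (Finset.filter_subset _ s))]
  · refine Finset.sum_congr rfl fun b _ => ?_
    let _ : MulAction H {a // a ∈ s ∧ f a = b} :=
      { smul := fun x a => ⟨φ x a, hs x a a.2.1, (hf x a a.2.1).trans a.2.2⟩
        one_smul := fun a => Subtype.ext (by change φ 1 (a : α) = a; simp)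
        mul_smul := fun x y a => Subtype.ext (by change φ (x * y) (a : α) = φ x (φ y a); simp) }
    have hfin : Finite {a // a ∈ s ∧ f a = b} :=
      Finite.of_injective (fun a => (⟨a.1, a.2.1⟩ : s)) fun a c h => Subtype.ext (by simpa using h)
    have hmod := hH.card_modEq_card_fixedPoints {a // a ∈ s ∧ f a = b}
    have e1 : Nat.card {a // a ∈ s ∧ f a = b} = (s.filter (f · = b)).card := by
      rw [← Nat.card_eq_finsetCard]
      exact Nat.card_congr (Equiv.subtypeEquivRight fun a => by simp)
    have e2 : Nat.card (MulAction.fixedPoints H {a // a ∈ s ∧ f a = b}) =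
        ((s.filter fun a => ∀ x, φ x a = a).filter (f · = b)).card := by
      rw [← Nat.card_eq_finsetCard]
      refine Nat.card_congr ⟨fun a => ⟨a.1.1, ?_⟩, fun a => ⟨⟨a.1, ?_⟩, ?_⟩, ?_, ?_⟩
      · simpa using ⟨⟨a.1.2.1, fun x => congrArg Subtype.val (a.2 x)⟩, a.1.2.2⟩
      · have := a.2
        simp only [Finset.mem_filter] at this
        exact ⟨this.1.1, this.2⟩
      · have := a.2
        simp only [Finset.mem_filter] at this
        exact fun x => Subtype.ext (this.1.2 x)
      · exact fun a => rfl
      · exact fun a => rfl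
    rw [e1, e2] at hmod
    have key : ∀ m : ℕ, m • b = (m % p) • b := fun m => by
      conv_lhs => rw [← Nat.div_add_mod m p, add_smul, mul_comm, mul_smul, hM, smul_zero, zero_add]
    rw [key, hmod, ← key]
  · intro b _ hb
    rw [Finset.card_eq_zero.2, zero_smul]
    exact Finset.filter_eq_empty_iff.2 fun a ha h => hb (h ▸ Finset.mem_image_of_mem f ha)

/-! ### The Brauer homomorphism and the blocks of `kC_G(Q)`, realised inside `kG`. -/

section Truncation

variable {k G : Type*} [Field k] [Group G]

theorem coeff_groupAlgebraConj (x : G) (a : MonoidAlgebra k G) (g : G) :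
    (groupAlgebraConj k x a).coeff g = a.coeff (x⁻¹ * g * x) := by
  simp [groupAlgebraConj]

theorem groupAlgebraConj_one (a : MonoidAlgebra k G) : groupAlgebraConj k 1 a = a := by
  ext g; simp [coeff_groupAlgebraConj]

theorem groupAlgebraConj_mul (x y : G) (a : MonoidAlgebra k G) :
    groupAlgebraConj k (x * y) a = groupAlgebraConj k x (groupAlgebraConj k y a) := by
  ext g; simp [coeff_groupAlgebraConj, mul_assoc]

theorem coeff_of_mem_fixedSubalgebra {P : Subgroup G} {a : MonoidAlgebra k G}
    (ha : a ∈ fixedSubalgebra k P) {x : G} (hx : x ∈ P) (g : G) :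
    a.coeff (x * g * x⁻¹) = a.coeff g := by
  conv_lhs => rw [← ha x hx]
  rw [coeff_groupAlgebraConj]
  congr 1
  group

open Classical in
/-- The truncation of an element of `kG` to `C_G(Q)`, as an element of `kG`. -/
noncomputable def centralizerTrunc (Q : Subgroup G) : MonoidAlgebra k G →ₗ[k] MonoidAlgebra k G where
  toFun a := MonoidAlgebra.ofCoeff (a.coeff.filter (· ∈ Subgroup.centralizer (Q : Set G)))
  map_add' a b := by ext g; simp
  map_smul' r a := by ext g; simp [Finsupp.filter_apply]

open Classical in
theorem coeff_centralizerTrunc (Q : Subgroup G) (a : MonoidAlgebra k G) (g : G) :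
    (centralizerTrunc Q a).coeff g =
      if g ∈ Subgroup.centralizer (Q : Set G) then a.coeff g else 0 := by
  simp [centralizerTrunc, Finsupp.filter_apply]

theorem mem_centralizer_iff_conj {Q : Subgroup G} {g : G} :
    g ∈ Subgroup.centralizer (Q : Set G) ↔ ∀ x ∈ Q, x * g * x⁻¹ = g := by
  rw [Subgroup.mem_centralizer_iff]
  exact forall₂_congr fun x _ => by rw [mul_inv_eq_iff_eq_mul]

theorem centralizer_anti {Q R : Subgroup G} (h : Q ≤ R) :
    Subgroup.centralizer (R : Set G) ≤ Subgroup.centralizer (Q : Set G) :=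
  Subgroup.centralizer_le h

/-- Transitivity `Br_R ∘ Br_Q = Br_R`, from `C_G(R) ≤ C_G(Q)`. In particular `Br_R(i) ≠ 0` forces
`Br_Q(i) ≠ 0`. -/
theorem centralizerTrunc_centralizerTrunc {Q R : Subgroup G} (h : Q ≤ R) (a : MonoidAlgebra k G) :
    centralizerTrunc R (centralizerTrunc Q a) = centralizerTrunc R a := by
  ext g
  simp only [coeff_centralizerTrunc]
  split_ifs with h1 h2
  · rfl
  · exact absurd (centralizer_anti h h1) h2
  · rfl

/-- The embedding `kC_G(Q) → kG`. -/
noncomputable def centralizerInclusion (k : Type*) [Field k] (Q : Subgroup G) :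
    MonoidAlgebra k (Subgroup.centralizer (Q : Set G)) →ₐ[k] MonoidAlgebra k G :=
  MonoidAlgebra.mapDomainAlgHom k k (Subgroup.centralizer (Q : Set G)).subtype

theorem centralizerInclusion_apply (Q : Subgroup G)
    (a : MonoidAlgebra k (Subgroup.centralizer (Q : Set G))) :
    centralizerInclusion k Q a =
      MonoidAlgebra.mapDomain (Subgroup.centralizer (Q : Set G)).subtype a := rfl

theorem centralizerInclusion_injective (Q : Subgroup G) :
    Function.Injective (centralizerInclusion k Q) :=
  MonoidAlgebra.mapDomain_injective Subtype.val_injective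

theorem coeff_centralizerInclusion (Q : Subgroup G)
    (a : MonoidAlgebra k (Subgroup.centralizer (Q : Set G)))
    (g : Subgroup.centralizer (Q : Set G)) :
    (centralizerInclusion k Q a).coeff g = a.coeff g := by
  rw [centralizerInclusion_apply]
  exact Finsupp.mapDomain_apply Subtype.val_injective _ _

theorem coeff_centralizerInclusion_of_notMem (Q : Subgroup G)
    (a : MonoidAlgebra k (Subgroup.centralizer (Q : Set G))) {g : G}
    (hg : g ∉ Subgroup.centralizer (Q : Set G)) :
    (centralizerInclusion k Q a).coeff g = 0 := by
  rw [centralizerInclusion_apply]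
  exact Finsupp.mapDomain_of_notMem_range _ _ (by simpa using hg)

theorem centralizerInclusion_brauerMap (Q : Subgroup G) (a : fixedSubalgebra k Q) :
    centralizerInclusion k Q (brauerMap k Q a) = centralizerTrunc Q (a : MonoidAlgebra k G) := by
  ext g
  rw [coeff_centralizerTrunc]
  split_ifs with h
  · lift g to Subgroup.centralizer (Q : Set G) using h
    rw [coeff_centralizerInclusion]
    rfl
  · exact coeff_centralizerInclusion_of_notMem Q _ h

/-- The subalgebra `kC_G(Q)` of `kG`. -/
noncomputable def centralizerSubalgebra (k : Type*) [Field k] (Q : Subgroup G) :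
    Subalgebra k (MonoidAlgebra k G) :=
  (centralizerInclusion k Q).range

theorem mem_centralizerSubalgebra {Q : Subgroup G} {a : MonoidAlgebra k G} :
    a ∈ centralizerSubalgebra k Q ↔ centralizerTrunc Q a = a := by
  constructor
  · rintro ⟨b, rfl⟩
    ext g
    rw [coeff_centralizerTrunc]
    split_ifs with h
    · rfl
    · exact (coeff_centralizerInclusion_of_notMem Q b h).symm
  · intro h
    refine ⟨MonoidAlgebra.comapDomain (Subgroup.centralizer (Q : Set G)).subtype
      Subtype.val_injective a, ?_⟩
    ext g
    conv_rhs => rw [← h]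
    rw [coeff_centralizerTrunc]
    split_ifs with h
    · lift g to Subgroup.centralizer (Q : Set G) using h
      exact coeff_centralizerInclusion Q _ g
    · exact coeff_centralizerInclusion_of_notMem Q _ h

theorem centralizerTrunc_mem (Q : Subgroup G) (a : MonoidAlgebra k G) :
    centralizerTrunc Q a ∈ centralizerSubalgebra k Q :=
  mem_centralizerSubalgebra.2 (centralizerTrunc_centralizerTrunc le_rfl a)

theorem centralizerSubalgebra_anti {Q R : Subgroup G} (h : Q ≤ R) :
    centralizerSubalgebra k R ≤ centralizerSubalgebra k Q := by
  intro a ha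
  rw [mem_centralizerSubalgebra] at ha ⊢
  ext g
  rw [coeff_centralizerTrunc]
  split_ifs with h1
  · rfl
  · rw [← ha, coeff_centralizerTrunc, if_neg fun h2 => h1 (centralizer_anti h h2)]

theorem centralizerSubalgebra_le_fixedSubalgebra (Q : Subgroup G) :
    centralizerSubalgebra k Q ≤ fixedSubalgebra k Q := by
  intro a ha x hx
  rw [mem_centralizerSubalgebra] at ha
  ext g
  rw [coeff_groupAlgebraConj]
  by_cases hg : g ∈ Subgroup.centralizer (Q : Set G)
  · congr 1
    simpa using mem_centralizer_iff_conj.1 hg x⁻¹ (inv_mem hx)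
  · rw [← ha, coeff_centralizerTrunc, coeff_centralizerTrunc, if_neg hg, if_neg]
    intro h
    refine hg ?_
    have := mem_centralizer_iff_conj.1 h x hx
    simp only [mul_assoc, mul_inv_cancel, mul_inv_cancel_left, mul_one] at this
    rw [this, ← mul_assoc]
    exact h

theorem conj_mem_centralizer_iff {N Q : Subgroup G} (hN : N ≤ Subgroup.normalizer (Q : Set G)) {x : G}
    (hx : x ∈ N) {g : G} :
    x⁻¹ * g * x ∈ Subgroup.centralizer (Q : Set G) ↔ g ∈ Subgroup.centralizer (Q : Set G) := by
  rw [mem_centralizer_iff_conj, mem_centralizer_iff_conj]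
  have hn := Subgroup.mem_normalizer_iff.1 (hN hx)
  constructor
  · intro h y hy
    have := h (x⁻¹ * y * x) (by rw [hn]; simpa [mul_assoc] using hy)
    have h2 := congrArg (fun z => x * z * x⁻¹) this
    simpa [mul_assoc] using h2
  · intro h y hy
    have h1 := h _ ((hn y).1 hy)
    have h2 := congrArg (fun z => x⁻¹ * z * x) h1
    simpa [mul_assoc] using h2

theorem centralizerTrunc_conj {Q : Subgroup G} {x : G} (hx : x ∈ Subgroup.normalizer (Q : Set G))
    (a : MonoidAlgebra k G) :
    centralizerTrunc Q (groupAlgebraConj k x a) = groupAlgebraConj k x (centralizerTrunc Q a) := by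
  classical
  ext g
  rw [coeff_groupAlgebraConj, coeff_centralizerTrunc, coeff_centralizerTrunc,
    coeff_groupAlgebraConj]
  simp only [conj_mem_centralizer_iff le_rfl hx]

theorem groupAlgebraConj_mem_centralizerSubalgebra {Q : Subgroup G} {x : G}
    (hx : x ∈ Subgroup.normalizer (Q : Set G)) {a : MonoidAlgebra k G}
    (ha : a ∈ centralizerSubalgebra k Q) :
    groupAlgebraConj k x a ∈ centralizerSubalgebra k Q := by
  rw [mem_centralizerSubalgebra] at ha ⊢
  rw [centralizerTrunc_conj hx, ha]

/-- The centre of the subalgebra `kC_G(Q)` of `kG`. -/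
noncomputable def centralizerCenter (k : Type*) [Field k] (Q : Subgroup G) :
    Subalgebra k (MonoidAlgebra k G) :=
  centralizerSubalgebra k Q ⊓
    Subalgebra.centralizer k (centralizerSubalgebra k Q : Set (MonoidAlgebra k G))

theorem mem_centralizerCenter {Q : Subgroup G} {c : MonoidAlgebra k G} :
    c ∈ centralizerCenter k Q ↔ c ∈ centralizerSubalgebra k Q ∧
      ∀ s ∈ centralizerSubalgebra k Q, s * c = c * s :=
  Iff.rfl

theorem centralizerCenter_comm (Q : Subgroup G) : ∀ a ∈ centralizerCenter k Q,
    ∀ b ∈ centralizerCenter k Q, a * b = b * a :=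
  fun _ ha _ hb => (mem_centralizerCenter.1 hb).2 _ ha.1

theorem groupAlgebraConj_mem_centralizerCenter {Q : Subgroup G} {x : G}
    (hx : x ∈ Subgroup.normalizer (Q : Set G)) {c : MonoidAlgebra k G}
    (hc : c ∈ centralizerCenter k Q) : groupAlgebraConj k x c ∈ centralizerCenter k Q := by
  refine ⟨groupAlgebraConj_mem_centralizerSubalgebra hx hc.1, fun s hs => ?_⟩
  have h := hc.2 _ (groupAlgebraConj_mem_centralizerSubalgebra (inv_mem hx) hs)
  have h2 := congrArg (groupAlgebraConj k x) h
  rwa [map_mul, map_mul, ← groupAlgebraConj_mul, mul_inv_cancel, groupAlgebraConj_one] at h2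

theorem groupAlgebraConj_isPrimitiveIn {Q : Subgroup G} {x : G}
    (hx : x ∈ Subgroup.normalizer (Q : Set G)) {f : MonoidAlgebra k G}
    (hf : (centralizerCenter k Q).IsPrimitiveIn f) :
    (centralizerCenter k Q).IsPrimitiveIn (groupAlgebraConj k x f) := by
  obtain ⟨h1, h2, h3, h4⟩ := hf
  have hinv : ∀ a : MonoidAlgebra k G, groupAlgebraConj k x⁻¹ (groupAlgebraConj k x a) = a :=
    fun a => by rw [← groupAlgebraConj_mul, inv_mul_cancel, groupAlgebraConj_one]
  have hinv' : ∀ a : MonoidAlgebra k G, groupAlgebraConj k x (groupAlgebraConj k x⁻¹ a) = a :=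
    fun a => by rw [← groupAlgebraConj_mul, mul_inv_cancel, groupAlgebraConj_one]
  refine ⟨groupAlgebraConj_mem_centralizerCenter hx h1, by rw [← map_mul, h2], by simpa using h3,
    fun c hc hcc hl hr => ?_⟩
  have := h4 (groupAlgebraConj k x⁻¹ c) (groupAlgebraConj_mem_centralizerCenter (inv_mem hx) hc)
    (by rw [← map_mul, hcc]) (by rw [← hinv f, ← map_mul, hl]) (by rw [← hinv f, ← map_mul, hr])
  rcases this with h | h
  · left; simpa using h
  · right; rw [← h, hinv']

/-- Moves blocks into `kG`, so that blocks for different subgroups can be multiplied with each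
other. -/
theorem isBlockIdempotent_iff_isPrimitiveIn {Q : Subgroup G}
    {e : MonoidAlgebra k (Subgroup.centralizer (Q : Set G))} :
    IsBlockIdempotent e ↔ (centralizerCenter k Q).IsPrimitiveIn (centralizerInclusion k Q e) := by
  have hinj := centralizerInclusion_injective (k := k) Q
  have hmem : ∀ a, a ∈ Subring.center (MonoidAlgebra k (Subgroup.centralizer (Q : Set G))) ↔
      centralizerInclusion k Q a ∈ centralizerCenter k Q := by
    intro a
    rw [Subring.mem_center_iff, mem_centralizerCenter]
    constructor
    · refine fun h => ⟨⟨a, rfl⟩, ?_⟩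
      rintro _ ⟨b, rfl⟩
      exact (map_mul _ b a).symm.trans ((congrArg _ (h b)).trans (map_mul _ a b))
    · exact fun h g => hinj (by rw [map_mul, map_mul]; exact h.2 _ ⟨g, rfl⟩)
  rw [isBlockIdempotent_iff]
  constructor
  · rintro ⟨hc, hi, h0, hp⟩
    have hi : e * e = e := hi
    refine ⟨(hmem e).1 hc, by rw [← map_mul, hi], by simpa using (map_ne_zero_iff _ hinj).2 h0, ?_⟩
    intro c hcZ hcc h1 h2
    obtain ⟨b, rfl⟩ := hcZ.1
    change centralizerInclusion k Q b = 0 ∨ centralizerInclusion k Q b = _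
    change centralizerInclusion k Q b * centralizerInclusion k Q b = centralizerInclusion k Q b at hcc
    change _ * centralizerInclusion k Q b = centralizerInclusion k Q b at h1
    change centralizerInclusion k Q b * _ = centralizerInclusion k Q b at h2
    rw [← map_mul] at hcc h1 h2
    have hcc := hinj hcc
    have h1 := hinj h1
    have h2 := hinj h2
    have hb := (hmem b).2 hcZ
    rcases hp b hb (e - b) (sub_mem hc hb) hcc
      (by unfold IsIdempotentElem; rw [mul_sub, sub_mul, sub_mul, hi, hcc, h1, h2]; abel)
      (by rw [mul_sub, h2, hcc, sub_self]) (by abel) with h | h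
    · left; rw [h, map_zero]
    · right; rw [sub_eq_zero.1 h]
  · rintro ⟨hc, hi, h0, hp⟩
    have hc' := (hmem e).2 hc
    refine ⟨hc', hinj (by rw [map_mul, hi]), by rintro rfl; simp at h0, ?_⟩
    rintro a ha b hb hai hbi hab rfl
    have hai : a * a = a := hai
    have hba : b * a = 0 := (Subring.mem_center_iff.1 ha b).trans hab
    rcases hp _ ((hmem a).1 ha) (by rw [← map_mul, hai])
      (by rw [← map_mul, add_mul, hai, hba, add_zero])
      (by rw [← map_mul, mul_add, hai, hab, add_zero]) with h | h
    · exact Or.inl (hinj (by rw [h, map_zero]))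
    · exact Or.inr (by simpa using hinj h)

/-- The permutation action of `N` on `kG` by conjugation. -/
noncomputable def conjPerm (k : Type*) [Field k] (N : Subgroup G) :
    N →* Equiv.Perm (MonoidAlgebra k G) where
  toFun x := (groupAlgebraConj k (x : G)).toEquiv
  map_one' := by ext1 a; exact groupAlgebraConj_one a
  map_mul' x y := by ext1 a; exact groupAlgebraConj_mul (x : G) y a

theorem coeff_mul_eq_sum [Fintype G] (a b : MonoidAlgebra k G) (g : G) :
    (a * b).coeff g = ∑ x : G, a.coeff x * b.coeff (x⁻¹ * g) := by
  classical
  rw [MonoidAlgebra.coeff_mul, Finsupp.sum_fintype _ _ (by simp)]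
  refine Finset.sum_congr rfl fun x _ => ?_
  rw [Finsupp.sum_fintype _ _ (by simp), Finset.sum_eq_single (x⁻¹ * g)]
  · simp
  · exact fun y _ hy => if_neg fun h => hy (by rw [← h, inv_mul_cancel_left])
  · simp

variable {p : ℕ} [Fact p.Prime] [CharP k p] [Finite G]

/-- The Brauer homomorphism is multiplicative. -/
theorem centralizerTrunc_mul {P : Subgroup G} (hP : IsPGroup p P) {a b : MonoidAlgebra k G}
    (ha : a ∈ fixedSubalgebra k P) (hb : b ∈ fixedSubalgebra k P) :
    centralizerTrunc P (a * b) = centralizerTrunc P a * centralizerTrunc P b := by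
  classical
  have := Fintype.ofFinite G
  ext g
  rw [coeff_mul_eq_sum, coeff_centralizerTrunc]
  split_ifs with hg
  -- For `g ∈ C_G(P)` the summand `a(x) b(x⁻¹ g)` is invariant under conjugating `x` by `P`, so only
  -- the fixed points `x ∈ C_G(P)` survive modulo `p`.
  · rw [coeff_mul_eq_sum, hP.sum_eq_sum_fixed (M := k) (fun m => by simp)
      ((MulAut.toPerm G).comp (MulAut.conj.comp P.subtype)) Finset.univ (by simp),
      Finset.sum_filter]
    · refine Finset.sum_congr rfl fun x _ => ?_
      have hx : (∀ y : P, ((MulAut.toPerm G).comp (MulAut.conj.comp P.subtype)) y x = x) ↔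
          x ∈ Subgroup.centralizer (P : Set G) := by
        rw [mem_centralizer_iff_conj]
        exact ⟨fun h y hy => h ⟨y, hy⟩, fun h y => h y y.2⟩
      simp only [hx, coeff_centralizerTrunc]
      by_cases h : x ∈ Subgroup.centralizer (P : Set G)
      · rw [if_pos h, if_pos h, if_pos (mul_mem (inv_mem h) hg)]
      · rw [if_neg h, if_neg h, zero_mul]
    · intro y x _
      change a.coeff (y * x * (y : G)⁻¹) * b.coeff ((y * x * (y : G)⁻¹)⁻¹ * g) = _
      rw [coeff_of_mem_fixedSubalgebra ha y.2]
      congr 1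
      rw [← coeff_of_mem_fixedSubalgebra hb y.2 (x⁻¹ * g)]
      congr 1
      conv_lhs => rw [← mem_centralizer_iff_conj.1 hg y y.2]
      group
  · have := mem_centralizerSubalgebra.1
      (mul_mem (centralizerTrunc_mem P a) (centralizerTrunc_mem P b))
    rw [← coeff_mul_eq_sum, ← this, coeff_centralizerTrunc, if_neg hg]

end Truncation

/-! ### Existence of a block below a given one. -/

section BrauerPairs

variable {k G : Type*} [Field k] [Group G] {p : ℕ} [Fact p.Prime]

/-- Finite `p`-groups are nilpotent, so a proper subgroup is properly contained in its normalizer.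
-/
theorem IsPGroup.lt_normalizer_inf [Finite G] {Q C : Subgroup G} (hC : IsPGroup p C) (h : Q < C) :
    Q < Subgroup.normalizer (Q : Set G) ⊓ C := by
  have hnil : Group.IsNilpotent C := hC.isNilpotent
  have hlt := Group.normalizerCondition_of_isNilpotent (G := C) (Q.subgroupOf C)
    (lt_top_iff_ne_top.2 fun h' => h.not_ge (Subgroup.subgroupOf_eq_top.1 h'))
  rw [← Subgroup.subgroupOf_normalizer_eq h.le] at hlt
  refine lt_of_le_of_ne (le_inf Subgroup.le_normalizer h.le) fun heq => hlt.ne ?_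
  conv_lhs => rw [heq]
  exact Subgroup.inf_subgroupOf_right _ _

theorem centralizerTrunc_mem_fixedSubalgebra {Q R : Subgroup G}
    (hR : R ≤ Subgroup.normalizer (Q : Set G)) {a : MonoidAlgebra k G}
    (ha : a ∈ fixedSubalgebra k R) : centralizerTrunc Q a ∈ fixedSubalgebra k R :=
  fun x hx => by rw [← centralizerTrunc_conj (hR hx), ha x hx]

theorem centralizerTrunc_one (Q : Subgroup G) :
    centralizerTrunc Q (1 : MonoidAlgebra k G) = 1 :=
  mem_centralizerSubalgebra.1 (one_mem _)

variable [CharP k p] [Finite G]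

theorem centralizerTrunc_mem_centralizerCenter {Q R : Subgroup G} (hR : IsPGroup p R) (h : Q ≤ R)
    {c : MonoidAlgebra k G} (hc : c ∈ centralizerCenter k Q) (hfix : c ∈ fixedSubalgebra k R) :
    centralizerTrunc R c ∈ centralizerCenter k R := by
  refine ⟨centralizerTrunc_mem R c, fun s hs => ?_⟩
  have hsR := centralizerSubalgebra_le_fixedSubalgebra R hs
  have := congrArg (centralizerTrunc R) (hc.2 s (centralizerSubalgebra_anti h hs))
  rwa [centralizerTrunc_mul hR hsR hfix, centralizerTrunc_mul hR hfix hsR,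
    mem_centralizerSubalgebra.1 hs] at this

/-- `Br_R(c)` is a central idempotent of `kC_G(R)`, so it either contains the block `e` or is
orthogonal to it. -/
theorem centralizerTrunc_mul_block_eq_or {Q R : Subgroup G} (hR : IsPGroup p R) (h : Q ≤ R)
    {c e : MonoidAlgebra k G} (hc : c ∈ centralizerCenter k Q) (hcc : c * c = c)
    (hfix : c ∈ fixedSubalgebra k R) (he : (centralizerCenter k R).IsPrimitiveIn e) :
    centralizerTrunc R c * e = 0 ∨ centralizerTrunc R c * e = e := by
  have hmem := centralizerTrunc_mem_centralizerCenter hR h hc hfix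
  exact he.mul_eq_or hmem (by rw [← centralizerTrunc_mul hR hfix hfix, hcc])
    (centralizerCenter_comm R _ hmem _ he.1)

/-- For `Q` normal in the `p`-group `R`, every block of `kC_G(R)` is covered by an `R`-stable block
of `kC_G(Q)`. -/
theorem exists_stable_block {Q R : Subgroup G} (hR : IsPGroup p R) (h : Q ≤ R)
    (hN : R ≤ Subgroup.normalizer (Q : Set G)) {e : MonoidAlgebra k G}
    (he : (centralizerCenter k R).IsPrimitiveIn e) :
    ∃ f, (centralizerCenter k Q).IsPrimitiveIn f ∧ f ∈ fixedSubalgebra k R ∧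
      centralizerTrunc R f * e = e := by
  classical
  have hone := sum_isPrimitiveIn_eq_one (centralizerCenter_comm (k := k) Q)
  set s := (finite_setOf_isPrimitiveIn (centralizerCenter_comm (k := k) Q)).toFinset with hs
  have hmem : ∀ f, f ∈ s ↔ (centralizerCenter k Q).IsPrimitiveIn f := fun f => by simp [hs]
  have hsum : ∑ f ∈ s, centralizerTrunc R f * e = e := by
    rw [← Finset.sum_mul, ← map_sum, hone, centralizerTrunc_one, one_mul]
  -- `R` permutes the blocks of `kC_G(Q)`, and `Br_R(f) e` is constant on orbits because `R` acts
  -- trivially on `kC_G(R)`. The total is `e ≠ 0`, so some `R`-stable block contributes.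
  rw [hR.sum_eq_sum_fixed (fun m => by rw [← Nat.cast_smul_eq_nsmul k]; simp)
    (conjPerm k R) s] at hsum
  · obtain ⟨f, hf, hne⟩ := Finset.exists_ne_zero_of_sum_ne_zero (hsum.trans_ne he.2.2.1)
    rw [Finset.mem_filter] at hf
    have hfix : f ∈ fixedSubalgebra k R := fun x hx => hf.2 ⟨x, hx⟩
    have hfp := (hmem f).1 hf.1
    exact ⟨f, hfp, hfix,
      (centralizerTrunc_mul_block_eq_or hR h hfp.1 hfp.2.1 hfix he).resolve_left hne⟩
  · exact fun x f hf => (hmem _).2 (groupAlgebraConj_isPrimitiveIn (hN x.2) ((hmem f).1 hf))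
  · intro x f hf
    change centralizerTrunc R (groupAlgebraConj k (x : G) f) * e = _
    rw [centralizerTrunc_conj (Subgroup.le_normalizer x.2),
      centralizerSubalgebra_le_fixedSubalgebra R (centralizerTrunc_mem R f) x x.2]

/-- An element of `kC_G(Q)` fixed by `N_P(Q)` and supported on elements with centralizer `Q` in `P`
lifts to an element of `(kG)^P` in the kernel of the Brauer homomorphism at `P`. -/
theorem exists_lift_of_support {P Q : Subgroup G} (hQP : Q < P) {d : MonoidAlgebra k G}
    (hd : d ∈ centralizerSubalgebra k Q)
    (hfix : d ∈ fixedSubalgebra k (Subgroup.normalizer (Q : Set G) ⊓ P))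
    (hsupp : ∀ g, d.coeff g ≠ 0 → ∀ y ∈ P, y * g * y⁻¹ = g → y ∈ Q) :
    ∃ u ∈ fixedSubalgebra k P, centralizerTrunc Q u = d ∧ centralizerTrunc P u = 0 := by
  classical
  have := Fintype.ofFinite P
  -- The image finset counts each distinct `P`-conjugate of `d` once, so its sum plays the role of a
  -- relative trace from `N_P(Q)` to `P`.
  let s : Finset (MonoidAlgebra k G) :=
    Finset.univ.image fun t : P => groupAlgebraConj k (t : G) d
  have htr : centralizerTrunc Q (∑ c ∈ s, c) = d := by
    rw [map_sum, Finset.sum_eq_single d]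
    · exact mem_centralizerSubalgebra.1 hd
    · intro c hc hne
      simp only [s, Finset.mem_image, Finset.mem_univ, true_and] at hc
      obtain ⟨t, rfl⟩ := hc
      by_contra h0
      have : ∃ g, (centralizerTrunc Q (groupAlgebraConj k (t : G) d)).coeff g ≠ 0 := by
        by_contra! h
        exact h0 (by ext g; simpa using h g)
      obtain ⟨g, hg⟩ := this
      rw [coeff_centralizerTrunc, coeff_groupAlgebraConj] at hg
      split_ifs at hg with hgc
      swap
      · exact hg rfl
      -- The element `t⁻¹ g t` lies in the support of `d` and is centralized by `t⁻¹ Q t`, so `t⁻¹ Q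
      -- t ≤ Q`. Then `t` normalizes `Q` and fixes `d`.
      have hn : (t : G)⁻¹ ∈ Subgroup.normalizer (Q : Set G) := by
        refine Subgroup.mem_normalizer_fintype fun y hy => ?_
        refine hsupp _ hg _ (mul_mem (mul_mem (inv_mem t.2) (hQP.le hy)) (by simp)) ?_
        conv_rhs => rw [← mem_centralizer_iff_conj.1 hgc y hy]
        group
      exact hne (hfix _ ⟨by simpa using Subgroup.inv_mem _ hn, t.2⟩)
    · intro h
      exact absurd (Finset.mem_image.2 ⟨1, Finset.mem_univ _, groupAlgebraConj_one d⟩) h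
  have hmem : ∀ x ∈ P, ∀ c ∈ s, groupAlgebraConj k x c ∈ s := by
    intro x hx c hc
    simp only [s, Finset.mem_image, Finset.mem_univ, true_and] at hc ⊢
    obtain ⟨t, rfl⟩ := hc
    exact ⟨⟨x * t, mul_mem hx t.2⟩, groupAlgebraConj_mul x t d⟩
  refine ⟨∑ c ∈ s, c, fun x hx => ?_, htr, ?_⟩
  · rw [map_sum]
    refine Finset.sum_nbij (groupAlgebraConj k x) (hmem x hx)
      (groupAlgebraConj k x).injective.injOn (fun c hc => ?_) (fun _ _ => rfl)
    exact ⟨groupAlgebraConj k x⁻¹ c, hmem _ (inv_mem hx) c hc,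
      by rw [← groupAlgebraConj_mul, mul_inv_cancel, groupAlgebraConj_one]⟩
  · rw [← centralizerTrunc_centralizerTrunc hQP.le, htr]
    ext g
    rw [coeff_centralizerTrunc]
    split_ifs with hg
    · by_contra hne
      exact hQP.not_ge fun y hy => hsupp g hne y hy (mem_centralizer_iff_conj.1 hg y hy)
    · rfl

/-- The vanishing at larger `R` forces the idempotent `d = Br_Q(i) c` to be supported on elements
whose centralizer in `P` is exactly `Q`. Such a `d` lifts to `(kG)^P` inside the kernel of `Br_P`,
and the local corner of `i` then forces `d = 0`. -/
theorem centralizerTrunc_mul_eq_zero {P Q : Subgroup G} (hP : IsPGroup p P) (hQP : Q < P)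
    {i c : MonoidAlgebra k G} (hi : (fixedSubalgebra k P).IsPrimitiveIn i)
    (hi0 : centralizerTrunc P i ≠ 0) (hc : c ∈ centralizerCenter k Q) (hcc : c * c = c)
    (hfix : c ∈ fixedSubalgebra k (Subgroup.normalizer (Q : Set G) ⊓ P))
    (h : ∀ R, Q < R → R ≤ Subgroup.normalizer (Q : Set G) ⊓ P →
      centralizerTrunc R i * centralizerTrunc R c = 0) :
    centralizerTrunc Q i * c = 0 := by
  have hQ : IsPGroup p Q := hP.to_le hQP.le
  have hiQ := fixedSubalgebra_anti hQP.le hi.1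
  have hI := centralizerTrunc_mem Q i
  have hIN : centralizerTrunc Q i ∈ fixedSubalgebra k (Subgroup.normalizer (Q : Set G) ⊓ P) :=
    centralizerTrunc_mem_fixedSubalgebra inf_le_left (fixedSubalgebra_anti inf_le_right hi.1)
  have hII : centralizerTrunc Q i * centralizerTrunc Q i = centralizerTrunc Q i := by
    rw [← centralizerTrunc_mul hQ hiQ hiQ, hi.2.1]
  have hcI := hc.2 _ hI
  set d := centralizerTrunc Q i * c with hd
  have hdS : d ∈ centralizerSubalgebra k Q := mul_mem hI hc.1
  have hId : centralizerTrunc Q i * d = d := by rw [hd, ← mul_assoc, hII]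
  have hdI : d * centralizerTrunc Q i = d := by rw [hd, mul_assoc, ← hcI, ← mul_assoc, hII]
  have hdd : d * d = d := by
    conv_lhs => enter [2]; rw [hd]
    rw [← mul_assoc, hdI, hd, mul_assoc, hcc]
  have hdR : ∀ R, Q < R → R ≤ Subgroup.normalizer (Q : Set G) ⊓ P → centralizerTrunc R d = 0 := by
    intro R hR hRN
    rw [hd, centralizerTrunc_mul (hP.to_le (hRN.trans inf_le_right))
      (fixedSubalgebra_anti hRN hIN) (fixedSubalgebra_anti hRN hfix),
      centralizerTrunc_centralizerTrunc hR.le, h R hR hRN]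
  have hsupp : ∀ g, d.coeff g ≠ 0 → ∀ y ∈ P, y * g * y⁻¹ = g → y ∈ Q := by
    classical
    intro g hg y hy hyg
    have hgQ : g ∈ Subgroup.centralizer (Q : Set G) := by
      by_contra hn
      rw [← mem_centralizerSubalgebra.1 hdS, coeff_centralizerTrunc, if_neg hn] at hg
      exact hg rfl
    set C := P ⊓ Subgroup.centralizer {g} with hC
    have hyC : y ∈ C :=
      ⟨hy, Subgroup.mem_centralizer_singleton_iff.2 (mul_inv_eq_iff_eq_mul.1 hyg)⟩
    have hQC : Q ≤ C := fun z hz => ⟨hQP.le hz, Subgroup.mem_centralizer_singleton_iff.2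
      (mul_inv_eq_iff_eq_mul.1 (mem_centralizer_iff_conj.1 hgQ z hz))⟩
    by_contra hyQ
    have hlt : Q < C := lt_of_le_of_ne hQC fun heq => hyQ (heq ▸ hyC)
    -- Test with `R = N_C(Q)`, where `C = C_P(g)`: it properly contains `Q` and centralizes `g`, so
    -- `Br_R` keeps the coefficient of `d` at `g`.
    have hz := hdR _ ((hP.to_le inf_le_left).lt_normalizer_inf hlt)
      (inf_le_inf_left _ inf_le_left)
    have := congrArg (fun a => a.coeff g) hz
    simp only [coeff_centralizerTrunc] at this
    rw [if_pos] at this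
    · exact hg this
    · rw [mem_centralizer_iff_conj]
      exact fun z hz =>
        mul_inv_eq_iff_eq_mul.2 (Subgroup.mem_centralizer_singleton_iff.1 hz.2.2)
  have hdN : d ∈ fixedSubalgebra k (Subgroup.normalizer (Q : Set G) ⊓ P) := mul_mem hIN hfix
  obtain ⟨u, hu, huQ, huP⟩ := exists_lift_of_support hQP hdS hdN hsupp
  -- Compress the lift to the corner of `i`; `Br_Q` still sends it to `d`. If it is nilpotent, so is
  -- the idempotent `d`, which is then zero. If it divides `i`, then `Br_P(i) = 0` because `Br_P(u)
  -- = 0`.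
  have ha : i * u * i ∈ fixedSubalgebra k P := mul_mem (mul_mem hi.1 hu) hi.1
  have haQ : centralizerTrunc Q (i * u * i) = d := by
    have huQ' := fixedSubalgebra_anti hQP.le hu
    rw [centralizerTrunc_mul hQ (mul_mem hiQ huQ') hiQ, centralizerTrunc_mul hQ hiQ huQ', huQ, hId,
      hdI]
  rcases hi.isNilpotent_or ha (by rw [← mul_assoc, ← mul_assoc, hi.2.1])
    (by rw [mul_assoc, hi.2.1]) with ⟨n, hn⟩ | ⟨b, hb, hab⟩
  · have hpow : ∀ m : ℕ, centralizerTrunc Q ((i * u * i) ^ (m + 1)) = d := by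
      intro m
      induction m with
      | zero => rw [zero_add, pow_one, haQ]
      | succ m ih =>
        have haQ' := fixedSubalgebra_anti hQP.le ha
        rw [pow_succ, centralizerTrunc_mul hQ (pow_mem haQ' _) haQ', ih, haQ, hdd]
    rw [← hpow n, pow_succ, hn, zero_mul, map_zero]
  · refine absurd ?_ hi0
    rw [← hab, centralizerTrunc_mul hP ha hb, centralizerTrunc_mul hP (mul_mem hi.1 hu) hi.1,
      centralizerTrunc_mul hP hi.1 hu, huP]
    simp

/-- For a block `e` of `kC_G(P)` and `Q ≤ P` there is a block `f` of `kC_G(Q)` with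
`(Q, f) ≤ (P, e)`. -/
theorem exists_block_le {P : Subgroup G} (hP : IsPGroup p P) {e : MonoidAlgebra k G}
    (he : (centralizerCenter k P).IsPrimitiveIn e) {Q : Subgroup G} (hQP : Q ≤ P) :
    ∃ f, (centralizerCenter k Q).IsPrimitiveIn f ∧ ∀ i, (fixedSubalgebra k P).IsPrimitiveIn i →
      e * centralizerTrunc P i = centralizerTrunc P i → centralizerTrunc P i ≠ 0 →
        f * centralizerTrunc Q i = centralizerTrunc Q i := by
  induction Q using WellFoundedGT.induction with
  | _ Q ih =>
  rcases hQP.eq_or_lt with rfl | hlt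
  · exact ⟨e, he, fun _ _ h _ => h⟩
  set N := Subgroup.normalizer (Q : Set G) ⊓ P with hN
  have hQN : Q < N := hP.lt_normalizer_inf hlt
  have hNp : IsPGroup p N := hP.to_le inf_le_right
  obtain ⟨fN, hfN, hfNi⟩ := ih N hQN inf_le_right
  obtain ⟨f, hf, hfix, hffN⟩ := exists_stable_block hNp hQN.le inf_le_left hfN
  refine ⟨f, hf, fun i hi hei hi0 => ?_⟩
  have hiN : i ∈ fixedSubalgebra k N := fixedSubalgebra_anti inf_le_right hi.1
  have hiN0 : centralizerTrunc N i ≠ 0 := fun h0 => hi0 (by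
    rw [← centralizerTrunc_centralizerTrunc (inf_le_right : N ≤ P), h0, map_zero])
  have hfN' : centralizerTrunc N f * centralizerTrunc N i = centralizerTrunc N i := by
    rw [← hfNi i hi hei hi0, ← mul_assoc, hffN]
  have key : centralizerTrunc Q i * (1 - f) = 0 := by
    refine centralizerTrunc_mul_eq_zero hP hlt hi hi0 (sub_mem (one_mem _) hf.1)
      (by rw [mul_sub, sub_mul, sub_mul, hf.2.1]; simp) (sub_mem (one_mem _) hfix) ?_
    intro R hQR hRN
    have hRp : IsPGroup p R := hNp.to_le hRN
    have hfR := fixedSubalgebra_anti hRN hfix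
    have hiR := fixedSubalgebra_anti hRN hiN
    obtain ⟨fR, hfR', hfRi⟩ := ih R hQR (hRN.trans inf_le_right)
    have hcomm := (centralizerTrunc_mem_centralizerCenter hRp hQR.le hf.1 hfR).2 _
      (centralizerTrunc_mem R i)
    have hone : centralizerTrunc R f * centralizerTrunc R i = centralizerTrunc R i := by
      -- If `Br_R(f)` missed the block found at `R`, then `Br_R(f i) = 0`. Applying `Br_N` would
      -- give `Br_N(f) Br_N(i) = 0`, whereas this product is `Br_N(i) ≠ 0`.
      rcases centralizerTrunc_mul_block_eq_or hRp hQR.le hf.1 hf.2.1 hfR hfR' with h0 | h1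
      · refine absurd ?_ hiN0
        have hz : centralizerTrunc R (f * i) = 0 := by
          rw [centralizerTrunc_mul hRp hfR hiR, ← hfRi i hi hei hi0, ← mul_assoc, h0, zero_mul]
        rw [← hfN', ← centralizerTrunc_mul hNp hfix hiN,
          ← centralizerTrunc_centralizerTrunc hRN, hz, map_zero]
      · rw [← hfRi i hi hei hi0, ← mul_assoc, h1]
    rw [map_sub, centralizerTrunc_one, mul_sub, mul_one, hcomm, hone, sub_self]
  rw [mul_sub, mul_one, sub_eq_zero] at key
  rw [← hf.1.2 _ (centralizerTrunc_mem Q i), ← key]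

/-- If an idempotent `i` of `(kG)^P` satisfies `e Br_P(i) ≠ 0` for a block `e` of `kC_G(P)`, then it
has a primitive constituent associated to `(P, e)`. -/
theorem exists_primitive_associated {P : Subgroup G} (hP : IsPGroup p P) {e i : MonoidAlgebra k G}
    (he : (centralizerCenter k P).IsPrimitiveIn e) (hi : i ∈ fixedSubalgebra k P) (hii : i * i = i)
    (hei : e * centralizerTrunc P i ≠ 0) :
    ∃ j, (fixedSubalgebra k P).IsPrimitiveIn j ∧ i * j = j ∧ j * i = j ∧
      e * centralizerTrunc P j = centralizerTrunc P j ∧ centralizerTrunc P j ≠ 0 := by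
  obtain ⟨j, hj, h1, h2, h3⟩ := exists_isPrimitiveIn_map_ne_zero (Z := fixedSubalgebra k P)
    ((AddMonoidHom.mulLeft e).comp (centralizerTrunc P).toAddMonoidHom) hi hii hei
  change e * centralizerTrunc P j ≠ 0 at h3
  refine ⟨j, hj, h1, h2, ?_, fun h0 => h3 (by rw [h0, mul_zero])⟩
  have heP := centralizerSubalgebra_le_fixedSubalgebra P he.1.1
  have hJJ : centralizerTrunc P j * centralizerTrunc P j = centralizerTrunc P j := by
    rw [← centralizerTrunc_mul hP hj.1 hj.1, hj.2.1]
  have hcomm := he.1.2 _ (centralizerTrunc_mem P j)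
  -- The corner of `j` is local, and `jej` has image `e Br_P(j)`, a nonzero idempotent, so `jej` is
  -- not nilpotent. It therefore divides `j`, which puts `Br_P(j)` inside `e kC_G(P)`.
  have ha : j * e * j ∈ fixedSubalgebra k P := mul_mem (mul_mem hj.1 heP) hj.1
  have hatr : centralizerTrunc P (j * e * j) = e * centralizerTrunc P j := by
    rw [centralizerTrunc_mul hP (mul_mem hj.1 heP) hj.1, centralizerTrunc_mul hP hj.1 heP,
      mem_centralizerSubalgebra.1 he.1.1, hcomm, mul_assoc, hJJ]
  rcases hj.isNilpotent_or ha (by rw [← mul_assoc, ← mul_assoc, hj.2.1])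
    (by rw [mul_assoc, hj.2.1]) with ⟨n, hn⟩ | ⟨b, hb, hab⟩
  · have hpow : ∀ m : ℕ, centralizerTrunc P ((j * e * j) ^ (m + 1)) = e * centralizerTrunc P j := by
      intro m
      induction m with
      | zero => rw [zero_add, pow_one, hatr]
      | succ m ih =>
        rw [pow_succ, centralizerTrunc_mul hP (pow_mem ha _) ha, ih, hatr, mul_assoc,
          ← mul_assoc _ e, hcomm, mul_assoc, hJJ, ← mul_assoc, he.2.1]
    refine absurd ?_ h3
    rw [← hpow n, pow_succ, hn, zero_mul, map_zero]
  · have : centralizerTrunc P j = e * (centralizerTrunc P j * centralizerTrunc P b) := by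
      conv_lhs => rw [← hab, centralizerTrunc_mul hP ha hb, hatr, mul_assoc]
    rw [this, ← mul_assoc, he.2.1]

end BrauerPairs

/-! ### Compatibility of the Galois action and of scalar extension with the Brauer homomorphism. -/

section GaloisAction

variable {K L G : Type*} [Field K] [Field L] [Algebra K L] [Group G]

theorem coeff_galois_smul (γ : L ≃ₐ[K] L) (a : MonoidAlgebra L G) (g : G) :
    (γ • a).coeff g = γ (a.coeff g) := rfl

theorem coeff_groupAlgebraEmbedding (a : MonoidAlgebra K G) (g : G) :
    (groupAlgebraEmbedding K L G a).coeff g = algebraMap K L (a.coeff g) := by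
  simp [groupAlgebraEmbedding]

theorem galois_smul_groupAlgebraConj (γ : L ≃ₐ[K] L) (x : G) (a : MonoidAlgebra L G) :
    γ • groupAlgebraConj L x a = groupAlgebraConj L x (γ • a) := by
  ext g
  simp only [coeff_galois_smul, coeff_groupAlgebraConj]

theorem galois_smul_mem_fixedSubalgebra (γ : L ≃ₐ[K] L) {P : Subgroup G} {a : MonoidAlgebra L G}
    (ha : a ∈ fixedSubalgebra L P) : γ • a ∈ fixedSubalgebra L P :=
  fun x hx => by rw [← galois_smul_groupAlgebraConj, ha x hx]

theorem galois_smul_isPrimitiveIn (γ : L ≃ₐ[K] L) {P : Subgroup G} {i : MonoidAlgebra L G}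
    (hi : (fixedSubalgebra L P).IsPrimitiveIn i) : (fixedSubalgebra L P).IsPrimitiveIn (γ • i) := by
  obtain ⟨h1, h2, h3, h4⟩ := hi
  refine ⟨galois_smul_mem_fixedSubalgebra γ h1, by rw [← galois_smul_mul, h2],
    fun h => h3 ((smul_eq_zero_iff_eq γ).1 h), fun c hc hcc hl hr => ?_⟩
  have := h4 (γ⁻¹ • c) (galois_smul_mem_fixedSubalgebra _ hc) (by rw [← galois_smul_mul, hcc])
    (by rw [← inv_smul_smul γ i, ← galois_smul_mul, hl])
    (by rw [← inv_smul_smul γ i, ← galois_smul_mul, hr])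
  exact this.imp (smul_eq_zero_iff_eq γ⁻¹).1 inv_smul_eq_iff.1

theorem galois_smul_centralizerTrunc (γ : L ≃ₐ[K] L) (Q : Subgroup G) (a : MonoidAlgebra L G) :
    γ • centralizerTrunc Q a = centralizerTrunc Q (γ • a) := by
  classical
  ext g
  simp only [coeff_galois_smul, coeff_centralizerTrunc]
  split_ifs <;> simp

theorem galois_smul_centralizerInclusion (γ : L ≃ₐ[K] L) (Q : Subgroup G)
    (a : MonoidAlgebra L (Subgroup.centralizer (Q : Set G))) :
    γ • centralizerInclusion L Q a = centralizerInclusion L Q (γ • a) := by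
  ext g
  rw [coeff_galois_smul]
  by_cases hg : g ∈ Subgroup.centralizer (Q : Set G)
  · lift g to Subgroup.centralizer (Q : Set G) using hg
    rw [coeff_centralizerInclusion, coeff_centralizerInclusion, coeff_galois_smul]
  · rw [coeff_centralizerInclusion_of_notMem Q _ hg, coeff_centralizerInclusion_of_notMem Q _ hg,
      map_zero]

theorem groupAlgebraEmbedding_mem_fixedSubalgebra {P : Subgroup G} {a : MonoidAlgebra K G}
    (ha : a ∈ fixedSubalgebra K P) : groupAlgebraEmbedding K L G a ∈ fixedSubalgebra L P := by
  intro x hx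
  ext g
  rw [coeff_groupAlgebraConj, coeff_groupAlgebraEmbedding, coeff_groupAlgebraEmbedding,
    ← coeff_groupAlgebraConj, ha x hx]

theorem groupAlgebraEmbedding_centralizerTrunc (Q : Subgroup G) (a : MonoidAlgebra K G) :
    groupAlgebraEmbedding K L G (centralizerTrunc Q a) =
      centralizerTrunc Q (groupAlgebraEmbedding K L G a) := by
  classical
  ext g
  simp only [coeff_groupAlgebraEmbedding, coeff_centralizerTrunc]
  split_ifs <;> simp

theorem groupAlgebraEmbedding_centralizerInclusion (Q : Subgroup G)
    (a : MonoidAlgebra K (Subgroup.centralizer (Q : Set G))) :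
    groupAlgebraEmbedding K L G (centralizerInclusion K Q a) =
      centralizerInclusion L Q (groupAlgebraEmbedding K L _ a) := by
  ext g
  rw [coeff_groupAlgebraEmbedding]
  by_cases hg : g ∈ Subgroup.centralizer (Q : Set G)
  · lift g to Subgroup.centralizer (Q : Set G) using hg
    rw [coeff_centralizerInclusion, coeff_centralizerInclusion, coeff_groupAlgebraEmbedding]
  · rw [coeff_centralizerInclusion_of_notMem Q _ hg, coeff_centralizerInclusion_of_notMem Q _ hg,
      map_zero]

theorem galoisOrbitSum_smul (γ : L ≃ₐ[K] L) (b : MonoidAlgebra L G) :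
    galoisOrbitSum K (γ • b) = galoisOrbitSum K b := by
  rw [galoisOrbitSum, MulAction.orbit_smul, galoisOrbitSum]

variable [FiniteDimensional K L]

theorem exists_galoisOrbitSum_eq_sum (b : MonoidAlgebra L G) :
    ∃ s : Finset (MonoidAlgebra L G), (∀ c, c ∈ s ↔ ∃ γ : L ≃ₐ[K] L, γ • b = c) ∧
      galoisOrbitSum K b = ∑ c ∈ s, c := by
  have hfin : (MulAction.orbit (L ≃ₐ[K] L) b).Finite := Set.finite_range _
  exact ⟨hfin.toFinset, fun c => by rw [Set.Finite.mem_toFinset]; rfl,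
    finsum_mem_eq_finite_toFinset_sum _ hfin⟩

theorem IsBlockIdempotent.galoisOrbitSum_mul {b : MonoidAlgebra L G} (hb : IsBlockIdempotent b) :
    galoisOrbitSum K b * b = b := by
  obtain ⟨s, hs, hsum⟩ := exists_galoisOrbitSum_eq_sum (K := K) b
  rw [hsum, Finset.sum_mul, Finset.sum_eq_single b, ((isBlockIdempotent_iff b).1 hb).2.1.eq]
  · intro c hc hne
    obtain ⟨γ, rfl⟩ := (hs c).1 hc
    exact (hb.galois_smul γ).mul_eq_zero_of_ne hb hne
  · exact fun h => absurd ((hs b).2 ⟨1, one_smul _ b⟩) h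

/-- Block idempotents with the same orbit sum are Galois conjugate. -/
theorem IsBlockIdempotent.exists_smul_eq {b b' : MonoidAlgebra L G} (hb : IsBlockIdempotent b)
    (hb' : IsBlockIdempotent b') (h : galoisOrbitSum K b = galoisOrbitSum K b') :
    ∃ γ : L ≃ₐ[K] L, γ • b' = b := by
  obtain ⟨s, hs, hsum⟩ := exists_galoisOrbitSum_eq_sum (K := K) b'
  by_contra! hne
  refine ((isBlockIdempotent_iff b).1 hb).2.2.1 ?_
  rw [← hb.galoisOrbitSum_mul (K := K), h, hsum, Finset.sum_mul]
  refine Finset.sum_eq_zero fun c hc => ?_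
  obtain ⟨γ, rfl⟩ := (hs c).1 hc
  exact (hb'.galois_smul γ).mul_eq_zero_of_ne hb (hne γ)

end GaloisAction

namespace BrauerPair

variable {p : ℕ}

/-! ### Brauer pairs expressed inside `kG`. -/

section Embedded

variable {k G : Type*} [Field k] [Group G]

/-- The block idempotent of a Brauer pair, as an element of `kG`. -/
noncomputable def block (X : BrauerPair p k G) : MonoidAlgebra k G :=
  centralizerInclusion k X.subgroup X.idem

theorem block_isPrimitiveIn (X : BrauerPair p k G) :
    (centralizerCenter k X.subgroup).IsPrimitiveIn X.block :=
  isBlockIdempotent_iff_isPrimitiveIn.1 X.isBlockIdempotent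

theorem isAssociated_iff (X : BrauerPair p k G) (i : fixedSubalgebra k X.subgroup) :
    X.IsAssociated i ↔
      X.block * centralizerTrunc X.subgroup (i : MonoidAlgebra k G) =
        centralizerTrunc X.subgroup (i : MonoidAlgebra k G) ∧
      centralizerTrunc X.subgroup (i : MonoidAlgebra k G) ≠ 0 := by
  have hinj := centralizerInclusion_injective (k := k) X.subgroup
  rw [IsAssociated, ← hinj.eq_iff, ← map_ne_zero_iff (centralizerInclusion k X.subgroup) hinj,
    map_mul, centralizerInclusion_brauerMap, block]

/-- The nonvanishing half of association to `X` is dropped: it follows from `Br_P(i) ≠ 0` by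
transitivity. -/
theorem le_iff (X Y : BrauerPair p k G) :
    X ≤ Y ↔ X.subgroup ≤ Y.subgroup ∧ ∀ i, (fixedSubalgebra k Y.subgroup).IsPrimitiveIn i →
      Y.block * centralizerTrunc Y.subgroup i = centralizerTrunc Y.subgroup i →
      centralizerTrunc Y.subgroup i ≠ 0 →
        X.block * centralizerTrunc X.subgroup i = centralizerTrunc X.subgroup i := by
  constructor
  · rintro ⟨h, hle⟩
    refine ⟨h, fun i hi h1 h2 => ?_⟩
    exact ((isAssociated_iff X _).1 (hle ⟨i, hi.1⟩ (isPrimitiveIdempotent_iff_isPrimitiveIn.2 hi)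
      ((isAssociated_iff Y _).2 ⟨h1, h2⟩))).1
  · rintro ⟨h, hle⟩
    refine ⟨h, fun i hi hY => (isAssociated_iff X _).2 ?_⟩
    obtain ⟨h1, h2⟩ := (isAssociated_iff Y i).1 hY
    refine ⟨hle i (isPrimitiveIdempotent_iff_isPrimitiveIn.1 hi) h1 h2, fun h0 => h2 ?_⟩
    change centralizerTrunc X.subgroup (i : MonoidAlgebra k G) = 0 at h0
    rw [← centralizerTrunc_centralizerTrunc h, h0, map_zero]

/-- Two blocks of `kC_G(Q)` acting as the identity on a common nonzero element agree. -/
theorem eq_of_mul_eq {Q : Subgroup G} {e f a : MonoidAlgebra k G}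
    (he : (centralizerCenter k Q).IsPrimitiveIn e) (hf : (centralizerCenter k Q).IsPrimitiveIn f)
    (hea : e * a = a) (hfa : f * a = a) (ha : a ≠ 0) : e = f := by
  by_contra hne
  refine ha ?_
  rw [← hea, ← hfa, ← mul_assoc, he.mul_eq_zero (centralizerCenter_comm Q) hf hne, zero_mul]

variable [Fact p.Prime] [CharP k p] [Finite G]

theorem exists_associated (Y : BrauerPair p k G) :
    ∃ i, (fixedSubalgebra k Y.subgroup).IsPrimitiveIn i ∧
      Y.block * centralizerTrunc Y.subgroup i = centralizerTrunc Y.subgroup i ∧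
      centralizerTrunc Y.subgroup i ≠ 0 := by
  obtain ⟨i, hi, -, -, h⟩ := exists_primitive_associated Y.isPGroup Y.block_isPrimitiveIn
    (i := 1) (one_mem _) (one_mul 1)
    (by rw [centralizerTrunc_one, mul_one]; exact Y.block_isPrimitiveIn.2.2.1)
  exact ⟨i, hi, h⟩

theorem exists_le (Y : BrauerPair p k G) {Q : Subgroup G} (hQ : Q ≤ Y.subgroup) :
    ∃ e he, (⟨Q, Y.isPGroup.to_le hQ, e, he⟩ : BrauerPair p k G) ≤ Y := by
  obtain ⟨f, hf, hle⟩ := exists_block_le Y.isPGroup Y.block_isPrimitiveIn hQ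
  obtain ⟨e, rfl⟩ := hf.1.1
  exact ⟨e, isBlockIdempotent_iff_isPrimitiveIn.2 hf, (le_iff _ _).2 ⟨hQ, hle⟩⟩

end Embedded

/-! ### Brauer pairs under Galois conjugation and descent. -/

section Galois

variable {K L G : Type*} [Field K] [Field L] [Algebra K L] [Group G]

theorem block_smul (γ : L ≃ₐ[K] L) (X : BrauerPair p L G) : (γ • X).block = γ • X.block :=
  (galois_smul_centralizerInclusion γ X.subgroup X.idem).symm

theorem smul_le_smul (γ : L ≃ₐ[K] L) {X Y : BrauerPair p L G} (h : X ≤ Y) : γ • X ≤ γ • Y := by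
  rw [le_iff] at h ⊢
  refine ⟨h.1, fun i hi h1 h2 => ?_⟩
  change (γ • Y).block * centralizerTrunc Y.subgroup i = centralizerTrunc Y.subgroup i at h1
  change (γ • X).block * centralizerTrunc X.subgroup i = centralizerTrunc X.subgroup i
  have h3 := h.2 (γ⁻¹ • i) (galois_smul_isPrimitiveIn _ hi)
    (by
      rw [← galois_smul_centralizerTrunc, ← inv_smul_smul γ Y.block, ← galois_smul_mul,
        ← block_smul, h1])
    (by
      rw [← galois_smul_centralizerTrunc]
      exact fun h0 => h2 ((smul_eq_zero_iff_eq γ⁻¹).1 h0))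
  rw [block_smul, ← smul_inv_smul γ (centralizerTrunc X.subgroup i), ← galois_smul_mul,
    galois_smul_centralizerTrunc, h3]

variable [FiniteDimensional K L] [IsGalois K L]

theorem embedding_tilde_block (X : BrauerPair p L G) :
    groupAlgebraEmbedding K L G (X.tilde K).block =
      centralizerInclusion L X.subgroup (galoisOrbitSum K X.idem) := by
  rw [← embedding_tilde_idem]
  exact groupAlgebraEmbedding_centralizerInclusion _ _

theorem embedding_tilde_block_mul (X : BrauerPair p L G) :
    groupAlgebraEmbedding K L G (X.tilde K).block * X.block = X.block := by
  rw [embedding_tilde_block, block, ← map_mul, X.isBlockIdempotent.galoisOrbitSum_mul]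

/-- A Galois-fixed element killed by one block is killed by all its conjugates, hence by their sum.
-/
theorem embedding_tilde_block_mul_eq_zero (X : BrauerPair p L G) {a : MonoidAlgebra L G}
    (ha : ∀ γ : L ≃ₐ[K] L, γ • a = a) (h : X.block * a = 0) :
    groupAlgebraEmbedding K L G (X.tilde K).block * a = 0 := by
  obtain ⟨s, hs, hsum⟩ := exists_galoisOrbitSum_eq_sum (K := K) X.idem
  rw [embedding_tilde_block, hsum, map_sum, Finset.sum_mul]
  refine Finset.sum_eq_zero fun c hc => ?_
  obtain ⟨γ, rfl⟩ := (hs c).1 hc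
  rw [← galois_smul_centralizerInclusion, ← ha γ, ← galois_smul_mul]
  exact (congrArg (γ • ·) h).trans (smul_zero γ)

theorem tilde_smul (γ : L ≃ₐ[K] L) (X : BrauerPair p L G) : (γ • X).tilde K = X.tilde K := by
  have : ((γ • X).tilde K).idem = (X.tilde K).idem := by
    apply groupAlgebraEmbedding_injective (K := K) (L := L)
    refine (embedding_tilde_idem (γ • X)).trans ?_
    exact (galoisOrbitSum_smul γ X.idem).trans (embedding_tilde_idem X).symm
  change BrauerPair.mk X.subgroup X.isPGroup ((γ • X).tilde K).idem _ =
    BrauerPair.mk X.subgroup X.isPGroup (X.tilde K).idem _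
  congr 1

variable [Fact p.Prime] [CharP K p] [Finite G]

theorem tilde_le_tilde {X Y : BrauerPair p L G} (h : X ≤ Y) : X.tilde K ≤ Y.tilde K := by
  have : CharP L p := charP_of_injective_algebraMap (algebraMap K L).injective p
  rw [le_iff] at h
  obtain ⟨hQP, hle⟩ := h
  have hQ := X.isPGroup
  obtain ⟨c, hc, hcle⟩ := exists_block_le (Y.tilde K).isPGroup (Y.tilde K).block_isPrimitiveIn hQP
  suffices hcX : c = (X.tilde K).block by
    subst hcX
    exact (le_iff _ _).2 ⟨hQP, hcle⟩
  obtain ⟨i, hi, h1, h2⟩ := (Y.tilde K).exists_associated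
  change centralizerTrunc Y.subgroup i ≠ 0 at h2
  have hci : c * centralizerTrunc X.subgroup i = centralizerTrunc X.subgroup i := hcle i hi h1 h2
  change (Y.tilde K).block * centralizerTrunc Y.subgroup i = centralizerTrunc Y.subgroup i at h1
  set Φ := groupAlgebraEmbedding K L G with hΦ
  have hinj : Function.Injective Φ := groupAlgebraEmbedding_injective
  have hΦi : Φ i ∈ fixedSubalgebra L Y.subgroup := groupAlgebraEmbedding_mem_fixedSubalgebra hi.1
  -- The idempotent `i` may split over `L`. Its image satisfies `e Br_P(i) ≠ 0`, since otherwise `ẽ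
  -- Br_P(i) = Br_P(i)` would vanish, so some constituent `j` is associated to `(P, e)`.
  obtain ⟨j, hj, hij, -, hj1, hj2⟩ := exists_primitive_associated Y.isPGroup Y.block_isPrimitiveIn
    (i := Φ i) hΦi (by rw [← map_mul, hi.2.1]) (by
      rw [← groupAlgebraEmbedding_centralizerTrunc]
      intro h0
      have := embedding_tilde_block_mul_eq_zero Y (fun γ => galois_smul_embedding γ _) h0
      rw [← map_mul, h1] at this
      exact h2 (hinj (this.trans (map_zero Φ).symm)))
  have hXj := hle j hj hj1 hj2
  have hXj0 : centralizerTrunc X.subgroup j ≠ 0 := fun h0 => hj2 (by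
    rw [← centralizerTrunc_centralizerTrunc hQP, h0, map_zero])
  have hcj : Φ c * centralizerTrunc X.subgroup j = centralizerTrunc X.subgroup j := by
    rw [← hij, centralizerTrunc_mul hQ (fixedSubalgebra_anti hQP hΦi)
      (fixedSubalgebra_anti hQP hj.1), ← groupAlgebraEmbedding_centralizerTrunc, ← mul_assoc,
      ← map_mul, hci]
  by_contra hne
  have hz : Φ c * Φ (X.tilde K).block = 0 := by
    rw [← map_mul, hc.mul_eq_zero (centralizerCenter_comm _) (X.tilde K).block_isPrimitiveIn hne,
      map_zero]
  refine hXj0 ?_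
  rw [← hcj, ← hXj, ← embedding_tilde_block_mul (K := K), mul_assoc, ← mul_assoc, hz, zero_mul]

end Galois

end BrauerPair

/-! ### The equivalence. -/

theorem proposition4p2 (p : ℕ) [Fact p.Prime] {K L : Type*} [Field K] [Field L] [CharP K p]
    [Algebra K L] [FiniteDimensional K L] [IsGalois K L] {G : Type*} [Group G] [Finite G]
    (X Y : BrauerPair p L G) (hXY : X.subgroup ≤ Y.subgroup) :
    X.tilde K ≤ Y.tilde K ↔ ∃ γ : L ≃ₐ[K] L, X ≤ γ • Y := by
  have : CharP L p := charP_of_injective_algebraMap (algebraMap K L).injective p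
  constructor
  · intro h
    obtain ⟨e, he, hle⟩ := Y.exists_le hXY
    have hle' := BrauerPair.tilde_le_tilde (K := K) hle
    set X' : BrauerPair p L G := ⟨X.subgroup, Y.isPGroup.to_le hXY, e, he⟩ with hX'
    obtain ⟨i, hi, h1, h2⟩ := (Y.tilde K).exists_associated
    have hi0 : centralizerTrunc X.subgroup i ≠ 0 := fun h0 => h2 (by
      change centralizerTrunc Y.subgroup i = 0
      rw [← centralizerTrunc_centralizerTrunc hXY, h0, map_zero])
    -- Uniqueness over `K`: both blocks lie below the block of `Y.tilde K`, so they act as the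
    -- identity on the same nonzero `Br_Q(i)`.
    have heq : (X.tilde K).block = (X'.tilde K).block :=
      BrauerPair.eq_of_mul_eq (X.tilde K).block_isPrimitiveIn (X'.tilde K).block_isPrimitiveIn
        (((BrauerPair.le_iff _ _).1 h).2 i hi h1 h2) (((BrauerPair.le_iff _ _).1 hle').2 i hi h1 h2)
        hi0
    have hsum : galoisOrbitSum K X.idem = galoisOrbitSum K e := by
      apply centralizerInclusion_injective X.subgroup
      rw [← BrauerPair.embedding_tilde_block, heq, BrauerPair.embedding_tilde_block]
    obtain ⟨γ, hγ⟩ := X.isBlockIdempotent.exists_smul_eq he hsum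
    refine ⟨γ, ?_⟩
    have hX : X = γ • X' := by
      change BrauerPair.mk X.subgroup X.isPGroup X.idem _ =
        BrauerPair.mk X.subgroup X.isPGroup (γ • e) _
      congr 1
      exact hγ.symm
    rw [hX]
    exact BrauerPair.smul_le_smul γ hle
  · rintro ⟨γ, h⟩
    have := BrauerPair.tilde_le_tilde (K := K) h
    rwa [BrauerPair.tilde_smul] at this
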